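/- **Setting.** Let $n,p$ be nonnegative integers, $X\in\mathbb R^{n\times p}$ with rows $x_i^{\mathsf T}$, $y\in[0,1]^n$, $\Sigma_\beta\in\mathbb R^{p\times p}$ symmetric positive definite, and $L\ge 1$ an integer. The *cobin* density with parameters $\theta\in\mathbb R$ and $1/l$, $l\in\{1,2,\dots\}$, is $p_{\mathrm{cobin}}(y;\theta,l^{-1})=h(y,l)\,e^{l\theta y}/\{(e^\theta-1)/\theta\}^{l}$ for $0\le y\le 1$ (with $(e^0-1)/0:=1$), where $h(y,1)=1$ and $h(y,l)=\frac{l}{(l-1)!}\sum_{k=0}^{l}(-1)^k\binom lk\max(ly-k,0)^{l-1}$ for $l\ge2$. For $b>0$, $c\in\mathbb R$, the *Kolmogorov–Gamma* law $\mathrm{KG}(b,c)$ is the law of $\frac1{2\pi^2}\sum_{k\ge1}\epsilon_k/(k^2+c^2/(4\pi^2))$ with $\epsilon_k$ i.i.d. $\mathrm{Gamma}(b,1)$. For $\kappa\in(0,\infty)^n$ and $\lambda\in\{1,\dots,L\}^n$ put $V_\beta=(X^{\mathsf T}\mathrm{diag}(\kappa)X+\Sigma_\beta^{-1})^{-1}$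 and $m_\beta=V_\beta X^{\mathsf T}(\lambda_i y_i-\lambda_i/2)_{i=1}^n$. A chain with $t$-step transition kernel $P^t$ is *uniformly ergodic* with limit $\Pi$ if there are $M>0$ and $\rho\in[0,1)$, independent of the initial state $\Theta$, such that $\|P^t(\Theta,\cdot)-\Pi\|_{\mathrm{TV}}\le M\rho^t$ for all $t\ge1$ and all $\Theta$. **Cobin sampler.** Let $p_\lambda$ be a probability mass function on $\{1,2,\dots\}$ (the prior of $\lambda$), let $\beta\sim N_p(0,\Sigma_\beta)$ a priori, and assume that some $l\le L$ has $p_\lambda(l)>0$ and, if $l\ge 2$, that all $y_i\in(0,1)$ (so that the data have positive likelihood). From $\Theta=((\lambda,\kappa),\beta)$, with $\lambda\in\{1,\dots,L\}$, $\kappa\in(0,\infty)^n$, $\beta\in\mathbb R^p$, one cycle draws successively: (1) $\lambda\in\{1,\dots,L\}$ with $\Pr(\lambda=l\mid\beta)\propto p_\lambda(l)\prod_{i}p_{\mathrm{cobin}}(y_i;x_i^{\mathsf T}\beta,l^{-1})$; (2) independent $\kappa_i\sim\mathrm{KG}(\lambda,x_i^{\mathsf T}\beta)$; (3) $\beta\sim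 N_p(m_\beta,V_\beta)$ with all $\lambda_i=\lambda$. Let $\Pi$ be the posterior of the augmented model restricted to $\lambda\le L$, i.e. the probability measure proportional to $$p_\lambda(\lambda)\prod_{i=1}^n h(y_i,\lambda)\,e^{\lambda(y_i-1/2)x_i^{\mathsf T}\beta-\kappa_i(x_i^{\mathsf T}\beta)^2/2}\,\mathrm{KG}(\lambda,0)(d\kappa_i)\;N_p(0,\Sigma_\beta)(d\beta).$$ **Micobin sampler.** Let $a_\psi,b_\psi>0$, and a priori $\beta\sim N_p(0,\Sigma_\beta)$, $\psi\sim\mathrm{Beta}(a_\psi,b_\psi)$, $\lambda_i-1\mid\psi\sim\mathrm{negbin}(2,\psi)$. From $\Theta=((\lambda_1,\dots,\lambda_n,\kappa),(\beta,\psi))$, with $\lambda_i\in\{1,\dots,L\}$, $\kappa\in(0,\infty)^n$, $\beta\in\mathbb R^p$, $\psi\in(0,1)$, one cycle draws successively: (1) independent $\lambda_i\in\{1,\dots,L\}$ with $\Pr(\lambda_i=l\mid\beta,\psi)\propto l(1-\psi)^{l-1}p_{\mathrm{cobin}}(y_i;x_i^{\mathsf T}\beta,l^{-1})$; (2) independent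 $\kappa_i\sim\mathrm{KG}(\lambda_i,x_i^{\mathsf T}\beta)$; (3) $\beta\sim N_p(m_\beta,V_\beta)$; (4) $\psi\sim\mathrm{Beta}(a_\psi+2n,\,b_\psi-n+\sum_i\lambda_i)$. Let $\Pi$ be the posterior of the augmented model restricted to $\lambda_1,\dots,\lambda_n\le L$, i.e. the probability measure proportional to $$\prod_{i=1}^n \lambda_i(1-\psi)^{\lambda_i-1}\psi^2\,h(y_i,\lambda_i)\,e^{\lambda_i(y_i-1/2)x_i^{\mathsf T}\beta-\kappa_i(x_i^{\mathsf T}\beta)^2/2}\,\mathrm{KG}(\lambda_i,0)(d\kappa_i)\;N_p(0,\Sigma_\beta)(d\beta)\,\mathrm{Beta}(a_\psi,b_\psi)(d\psi).$$ **Theorem.** Both samplers are uniformly ergodic: in each case the measure above can be normalized, one cycle defines a Markov kernel, and the chain of $\Theta$ is uniformly ergodic with limit $\Pi$. Likewise the marginal chain of $\beta$ (cobin), respectively of $(\beta,\psi)$ (micobin), is uniformly ergodic with limit the corresponding marginal of $\Pi$. -/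

import Mathlib

open MeasureTheory ProbabilityTheory
open scoped ENNReal Matrix

namespace CobinGibbs

noncomputable section

/-! ### Cobin density -/

/-- `(e^θ - 1) / θ`, with its limit value `1` at `θ = 0`. -/
def expDiv (θ : ℝ) : ℝ := if θ = 0 then 1 else (Real.exp θ - 1) / θ

/-- The base density `h(y, l)` of the cobin distribution for `0 ≤ y ≤ 1` and an integer `l ≥ 1`.
For `l = 1` it is the uniform density on `[0, 1]`; for `l ≥ 2` it is
`l / (l-1)! * ∑ k ≤ l, (-1)^k (l choose k) max(l y - k, 0)^(l-1)`.
The case `l = 1` is separated because Lean reads `0 ^ 0` as `1`. -/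
def cobinBase (y : ℝ) (l : ℕ) : ℝ :=
  if l = 1 then 1
  else (l : ℝ) / ((l - 1).factorial : ℝ) *
    ∑ k ∈ Finset.range (l + 1), (-1 : ℝ) ^ k * (l.choose k : ℝ) * (max (l * y - k) 0) ^ (l - 1)

/-- The density of `cobin(θ, 1/l)` at `y ∈ [0, 1]`. -/
def cobinDensity (y θ : ℝ) (l : ℕ) : ℝ :=
  cobinBase y l * Real.exp (l * θ * y) / expDiv θ ^ l

/-! ### Kolmogorov-Gamma distribution -/

/-- The Kolmogorov-Gamma law `KG(b, c)`: the law of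
`1 / (2π²) * ∑_{k ≥ 1} ε_k / (k² + c² / (4π²))` with `ε_k` i.i.d. `Gamma(b, 1)`. -/
def kg (b c : ℝ) : Measure ℝ :=
  (Measure.infinitePi fun _ : ℕ => gammaMeasure b 1).map fun ε =>
    1 / (2 * Real.pi ^ 2) * ∑' k : ℕ, ε k / (((k : ℝ) + 1) ^ 2 + c ^ 2 / (4 * Real.pi ^ 2))

/-- `KG(b, c)` as a measure on `(0, ∞)`. -/
def kgPos (b c : ℝ) : Measure (Set.Ioi (0 : ℝ)) := (kg b c).comap Subtype.val

/-- The beta distribution as a measure on `(0, 1)`. -/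
def betaUnit (a b : ℝ) : Measure (Set.Ioo (0 : ℝ) 1) := (betaMeasure a b).comap Subtype.val

/-! ### Building blocks of the samplers -/

/-- The distribution on a finite set with probabilities proportional to the weights `w`. -/
def discreteLaw {ι : Type*} [Fintype ι] [MeasurableSpace ι] (w : ι → ℝ) : Measure ι :=
  ∑ l, ENNReal.ofReal (w l / ∑ j, w j) • Measure.dirac l

/-- The measure `U` normalized to total mass one. -/
def normalize {α : Type*} [MeasurableSpace α] (U : Measure α) : Measure α :=
  (U Set.univ)⁻¹ • U

/-- The linear predictor `η_i = x_iᵀ β`. -/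
def linPred {n p : ℕ} (X : Matrix (Fin n) (Fin p) ℝ) (β : EuclideanSpace ℝ (Fin p)) (i : Fin n) :
    ℝ :=
  (X *ᵥ WithLp.ofLp β) i

/-- The conditional covariance `V_β = (Xᵀ diag(κ) X + Σ_β⁻¹)⁻¹`. -/
def condCov {n p : ℕ} (X : Matrix (Fin n) (Fin p) ℝ) (S : Matrix (Fin p) (Fin p) ℝ)
    (κ : Fin n → ℝ) : Matrix (Fin p) (Fin p) ℝ :=
  (Xᵀ * Matrix.diagonal κ * X + S⁻¹)⁻¹

/-- The law `N_p(m_β, V_β)` with `m_β = V_β Xᵀ (y_1 l_1 - l_1 / 2, …, y_n l_n - l_n / 2)ᵀ`. -/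
def condBeta {n p : ℕ} (X : Matrix (Fin n) (Fin p) ℝ) (y : Fin n → ℝ)
    (S : Matrix (Fin p) (Fin p) ℝ) (l : Fin n → ℕ) (κ : Fin n → ℝ) :
    Measure (EuclideanSpace ℝ (Fin p)) :=
  multivariateGaussian
    (WithLp.toLp 2 (condCov X S κ *ᵥ (Xᵀ *ᵥ fun i => y i * (l i : ℝ) - 0.5 * (l i : ℝ))))
    (condCov X S κ)

/-- The factor `h(y, l) exp(l (y - 1/2) η - κ η² / 2)` of the augmented likelihood of one
observation, i.e. its density with respect to `KG(l, 0)(dκ)` as a function of `κ`. -/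
def augFactor (y : ℝ) (l : ℕ) (η κ : ℝ) : ℝ :=
  cobinBase y l * Real.exp (l * (y - 0.5) * η - κ * η ^ 2 / 2)

/-! ### Two-block Gibbs samplers and uniform ergodicity -/

/-- One cycle of a two-block Gibbs sampler: from `(a, b)`, draw `a'` from `upd₁ b`, then `b'`
from `upd₂ a'`, and move to `(a', b')`. -/
def gibbsCycle {A B : Type*} [MeasurableSpace A] [MeasurableSpace B]
    (upd₁ : B → Measure A) (upd₂ : A → Measure B) (θ : A × B) : Measure (A × B) :=
  (upd₁ θ.2).bind fun a => (Measure.dirac a).prod (upd₂ a)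

/-- One step of the marginal chain of the second block. -/
def gibbsMarginal {A B : Type*} [MeasurableSpace A] [MeasurableSpace B]
    (upd₁ : B → Measure A) (upd₂ : A → Measure B) (b : B) : Measure B :=
  (upd₁ b).bind upd₂

/-- The total variation distance `sup_A |μ(A) - ν(A)|` of two probability measures. -/
def tvDist {α : Type*} [MeasurableSpace α] (μ ν : Measure α) : ℝ :=
  ⨆ A : {A : Set α // MeasurableSet A}, |μ.real A.1 - ν.real A.1|

/-- The map `step` is a Markov kernel (it depends measurably on the current state and its values
are probability measures), `target` is a probability measure, and the `t`-step transition
probabilities of the chain converge to `target` in total variation at a geometric rate that is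
uniform in the initial state. -/
def UniformlyErgodic {Θ : Type*} [MeasurableSpace Θ] (step : Θ → Measure Θ)
    (target : Measure Θ) : Prop :=
  IsProbabilityMeasure target ∧
  ∃ P : Kernel Θ Θ, IsMarkovKernel P ∧ (∀ θ, P θ = step θ) ∧
    ∃ M : ℝ, 0 < M ∧ ∃ ρ : ℝ, 0 ≤ ρ ∧ ρ < 1 ∧
      ∀ t : ℕ, 1 ≤ t → ∀ θ : Θ, tvDist ((P ^ t) θ) target ≤ M * ρ ^ t

/-! ### Cobin regression: blocks `(l, κ)` and `β` -/

/-- Steps 1 and 2 of a cycle for cobin regression: draw `l` in `{1, …, L}` with probability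
proportional to `p_λ(l) ∏ i, p_cobin(y_i; x_iᵀβ, 1/l)`, then independently
`κ_i ~ KG(l, x_iᵀβ)`. -/
def cobinLatent {n p : ℕ} (X : Matrix (Fin n) (Fin p) ℝ) (y : Fin n → ℝ) (pLam : PMF ℕ) (L : ℕ)
    (β : EuclideanSpace ℝ (Fin p)) : Measure (Set.Icc 1 L × (Fin n → Set.Ioi (0 : ℝ))) :=
  (discreteLaw fun l : Set.Icc 1 L =>
      (pLam (l : ℕ)).toReal * ∏ i, cobinDensity (y i) (linPred X β i) l).bind fun l =>
    (Measure.dirac l).prod (Measure.pi fun i => kgPos ((l : ℕ) : ℝ) (linPred X β i))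

/-- Step 3 of a cycle for cobin regression: draw `β ~ N_p(m_β, V_β)`. -/
def cobinParam {n p : ℕ} (X : Matrix (Fin n) (Fin p) ℝ) (y : Fin n → ℝ)
    (S : Matrix (Fin p) (Fin p) ℝ) (L : ℕ) (a : Set.Icc 1 L × (Fin n → Set.Ioi (0 : ℝ))) :
    Measure (EuclideanSpace ℝ (Fin p)) :=
  condBeta X y S (fun _ => (a.1 : ℕ)) (fun i => (a.2 i : ℝ))

/-- The posterior of `((l, κ), β)` in the augmented cobin regression model with priors
`β ~ N_p(0, S)` and `l ~ p_λ`, restricted to `l ≤ L`: the normalization of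
`p_λ(l) ∏ i, h(y_i, l) exp(l (y_i - 1/2) x_iᵀβ - κ_i (x_iᵀβ)² / 2) KG(l, 0)(dκ_i) N_p(0, S)(dβ)`. -/
def cobinPosterior {n p : ℕ} (X : Matrix (Fin n) (Fin p) ℝ) (y : Fin n → ℝ)
    (S : Matrix (Fin p) (Fin p) ℝ) (pLam : PMF ℕ) (L : ℕ) :
    Measure ((Set.Icc 1 L × (Fin n → Set.Ioi (0 : ℝ))) × EuclideanSpace ℝ (Fin p)) :=
  normalize <|
    (∑ l : Set.Icc 1 L,
      ((Measure.dirac l).prod (Measure.pi fun _ => kgPos ((l : ℕ) : ℝ) 0)).prod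
        (multivariateGaussian 0 S)).withDensity fun θ =>
      ENNReal.ofReal ((pLam (θ.1.1 : ℕ)).toReal *
        ∏ i, augFactor (y i) θ.1.1 (linPred X θ.2 i) (θ.1.2 i))

/-! ### Micobin regression: blocks `(l_1, …, l_n, κ)` and `(β, ψ)` -/

/-- Steps 1 and 2 of a cycle for micobin regression: independently over `i`, draw `l_i` in
`{1, …, L}` with probability proportional to `l (1-ψ)^(l-1) p_cobin(y_i; x_iᵀβ, 1/l)`, then
`κ_i ~ KG(l_i, x_iᵀβ)`. -/
def micobinLatent {n p : ℕ} (X : Matrix (Fin n) (Fin p) ℝ) (y : Fin n → ℝ) (L : ℕ)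
    (b : EuclideanSpace ℝ (Fin p) × Set.Ioo (0 : ℝ) 1) :
    Measure ((Fin n → Set.Icc 1 L) × (Fin n → Set.Ioi (0 : ℝ))) :=
  (Measure.pi fun i => discreteLaw fun l : Set.Icc 1 L =>
      ((l : ℕ) : ℝ) * (1 - (b.2 : ℝ)) ^ ((l : ℕ) - 1) *
        cobinDensity (y i) (linPred X b.1 i) l).bind fun l =>
    (Measure.dirac l).prod (Measure.pi fun i => kgPos ((l i : ℕ) : ℝ) (linPred X b.1 i))

/-- Steps 3 and 4 of a cycle for micobin regression: draw `β ~ N_p(m_β, V_β)` and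
`ψ ~ Beta(a_ψ + 2n, b_ψ - n + ∑ i, l_i)`, independently. -/
def micobinParam {n p : ℕ} (X : Matrix (Fin n) (Fin p) ℝ) (y : Fin n → ℝ)
    (S : Matrix (Fin p) (Fin p) ℝ) (aψ bψ : ℝ) (L : ℕ)
    (a : (Fin n → Set.Icc 1 L) × (Fin n → Set.Ioi (0 : ℝ))) :
    Measure (EuclideanSpace ℝ (Fin p) × Set.Ioo (0 : ℝ) 1) :=
  (condBeta X y S (fun i => (a.1 i : ℕ)) (fun i => (a.2 i : ℝ))).prod
    (betaUnit (aψ + 2 * (n : ℝ)) (bψ - (n : ℝ) + ∑ i, ((a.1 i : ℕ) : ℝ)))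

/-- The posterior of `((l_1, …, l_n, κ), (β, ψ))` in the augmented micobin regression model with
priors `β ~ N_p(0, S)` and `ψ ~ Beta(a_ψ, b_ψ)` and mixing law `l_i - 1 ~ negbin(2, ψ)`,
restricted to `l_1, …, l_n ≤ L`: the normalization of
`∏ i, l_i (1-ψ)^(l_i-1) ψ² h(y_i, l_i) exp(l_i (y_i - 1/2) x_iᵀβ - κ_i (x_iᵀβ)² / 2) KG(l_i, 0)(dκ_i)`
times `N_p(0, S)(dβ) Beta(a_ψ, b_ψ)(dψ)`. -/
def micobinPosterior {n p : ℕ} (X : Matrix (Fin n) (Fin p) ℝ) (y : Fin n → ℝ)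
    (S : Matrix (Fin p) (Fin p) ℝ) (aψ bψ : ℝ) (L : ℕ) :
    Measure (((Fin n → Set.Icc 1 L) × (Fin n → Set.Ioi (0 : ℝ))) ×
      (EuclideanSpace ℝ (Fin p) × Set.Ioo (0 : ℝ) 1)) :=
  normalize <|
    (∑ l : Fin n → Set.Icc 1 L,
      ((Measure.dirac l).prod (Measure.pi fun i => kgPos ((l i : ℕ) : ℝ) 0)).prod
        ((multivariateGaussian 0 S).prod (betaUnit aψ bψ))).withDensity fun θ =>
      ENNReal.ofReal (∏ i,
        ((θ.1.1 i : ℕ) : ℝ) * (1 - (θ.2.2 : ℝ)) ^ ((θ.1.1 i : ℕ) - 1) * (θ.2.2 : ℝ) ^ 2 *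
          augFactor (y i) (θ.1.1 i) (linPred X θ.2.1 i) (θ.1.2 i))

end

end CobinGibbs

open CobinGibbs

namespace CobinGibbs

/-! Both samplers are two-block Gibbs samplers: the latent block is (l, κ), and the parameter block
b is β or (β, ψ). The joint density has the form c(l) w(l, b) exp(-∑ κ_i η_i(b)²/2) with respect to
a product measure whose κ-part is KG(·, 0) and whose b-part is the prior. One cycle depends on the
current state only through b. By Doeblin's criterion (`uniformlyErgodic_of_minorization`) it
therefore suffices to find an invariant probability measure and one nonzero measure lying below the
law of the next b for every current b.

Invariance holds because the two updates are the two conditional laws of the joint density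
(`uniformlyErgodic_gibbs`). To see that they are, exponential tilting by exp(-κ c²/2) must turn
KG(l, 0) into KG(l, c). This is checked on Laplace transforms, which are infinite products over k
and match factor by factor (`laplace_kgSeries_tilt`, `ext_of_laplace`). The normalizing constant is
((c/2)/sinh(c/2))^l by Euler's sine product (`kgTilt_eq`), so integrating out κ leaves exactly the
cobin likelihood. The β and ψ updates are Gaussian and beta conjugacy.

The minorization (`uniformlyErgodic_augmented`) uses three bounds. The density of the next b' given
(l, κ) is w(l, b') exp(-∑ κ_i η_i(b')²/2) divided by a constant, and this constant is at most Z_l =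
∫ w(l, ·), because the exponential is at most 1. Next, the series for KG(l, c) has its largest
coefficients at c = 0, so averaging the exponential over κ_i ~ KG(l_i, η_i(b)) gives at least its
average under KG(l_i, 0), a bound free of b (`kgTilt_le_lintegral_kgPos`). Finally, the truncation
at L leaves finitely many l, so the minimum over l of the resulting bounds is still strictly
positive and bounds any mixture over l from below. -/

/-! ### Doeblin's criterion. -/

/-- If `ν ≤ μ`, the integral of a function with values in `[u, v]` against the probability
measure `μ` is confined to an interval of length `(1 - ν univ) (v - u)` that depends only on
`ν`, `u`, `v` and the function. -/
lemma integral_mem_Icc_of_le {B : Type*} [MeasurableSpace B] {μ ν : Measure B}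
    [IsProbabilityMeasure μ] [IsFiniteMeasure ν] (h : ν ≤ μ) {g : B → ℝ} (hg : Measurable g)
    {u v : ℝ} (hgu : ∀ b, u ≤ g b) (hgv : ∀ b, g b ≤ v) :
    ∫ b, g b ∂μ ∈ Set.Icc ((∫ b, g b ∂ν) + (1 - ν.real Set.univ) * u)
      ((∫ b, g b ∂ν) + (1 - ν.real Set.univ) * v) := by
  -- Split off the common part ν. Only the residual, of mass `1 - ν.real univ`, depends on μ, and it
  -- contributes between u and v times that mass.
  have hsub : (μ - ν) + ν = μ := Measure.sub_add_cancel_of_le h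
  have hint : ∀ κ : Measure B, IsFiniteMeasure κ → Integrable g κ := fun κ _ =>
    Integrable.of_mem_Icc u v hg.aemeasurable (.of_forall fun b => ⟨hgu b, hgv b⟩)
  have hfin : IsFiniteMeasure (μ - ν) := inferInstance
  have hmass : (μ - ν).real Set.univ = 1 - ν.real Set.univ := by
    have := measureReal_add_apply (μ₁ := μ - ν) (μ₂ := ν) (s := Set.univ)
    rw [hsub, probReal_univ] at this
    linarith
  have hI : ∫ b, g b ∂μ = (∫ b, g b ∂(μ - ν)) + ∫ b, g b ∂ν := by
    conv_lhs => rw [← hsub]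
    exact integral_add_measure (hint _ hfin) (hint _ inferInstance)
  have h1 : ∫ _, u ∂(μ - ν) ≤ ∫ b, g b ∂(μ - ν) :=
    integral_mono (integrable_const _) (hint _ hfin) hgu
  have h2 : ∫ b, g b ∂(μ - ν) ≤ ∫ _, v ∂(μ - ν) :=
    integral_mono (hint _ hfin) (integrable_const _) hgv
  rw [integral_const, hmass, smul_eq_mul] at h1 h2
  rw [hI]
  constructor <;> linarith

lemma isMarkovKernel_pow {Θ : Type*} [MeasurableSpace Θ] (P : Kernel Θ Θ) [IsMarkovKernel P]
    (t : ℕ) : IsMarkovKernel (P ^ t) := by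
  induction t with
  | zero => exact inferInstanceAs (IsMarkovKernel Kernel.id)
  | succ t ih => rw [pow_succ]; exact Kernel.IsMarkovKernel.comp _ _

section Doeblin

variable {Θ B : Type*} [MeasurableSpace Θ] [MeasurableSpace B]

/-- A minorization of the law of `s θ'`, for a transition that depends on the current state only
through `s θ`, makes the oscillation of the `t`-step probabilities decay geometrically. -/
lemma exists_Icc_pow_of_minorization {R : Kernel B Θ} [IsMarkovKernel R] {s : Θ → B}
    (hs : Measurable s) {ν : Measure B} [IsFiniteMeasure ν] (hν : ∀ b, ν ≤ (R b).map s)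
    (hν1 : ν.real Set.univ ≤ 1) {A : Set Θ} (hA : MeasurableSet A) (t : ℕ) :
    ∃ g : B → ℝ, Measurable g ∧ (∃ u v : ℝ, v - u ≤ (1 - ν.real Set.univ) ^ t ∧
      (∀ b, u ≤ g b ∧ g b ≤ v)) ∧ ∀ θ, (((R.comap s hs) ^ (t + 1)) θ).real A = g (s θ) := by
  induction t with
  | zero =>
    -- After one step only the trivial bounds 0 and 1 are available, so the contraction exponent
    -- lags one behind the number of steps.
    refine ⟨fun b => (R b).real A, ?_, ⟨0, 1, by simp, fun b => ⟨by positivity, ?_⟩⟩, ?_⟩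
    · exact (Kernel.measurable_coe R hA).ennreal_toReal
    · exact measureReal_le_one
    · intro θ; simp [Kernel.comap_apply]
  | succ t ih =>
    obtain ⟨g, hg, ⟨u, v, huv, hb⟩, hP⟩ := ih
    -- Condition on the first step. The new bounds come from `integral_mem_Icc_of_le` and do not
    -- involve b, so the width shrinks by the factor `1 - ν.real univ`.
    refine ⟨fun b => ∫ b', g b' ∂((R b).map s), ?_, ⟨(∫ b', g b' ∂ν) + (1 - ν.real Set.univ) * u,
      (∫ b', g b' ∂ν) + (1 - ν.real Set.univ) * v, ?_, fun b => ?_⟩, ?_⟩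
    · have : (fun b => ∫ b', g b' ∂((R b).map s)) = fun b => ∫ b', g b' ∂(R.map s b) := by
        ext b; rw [Kernel.map_apply _ hs]
      rw [this]
      exact (StronglyMeasurable.integral_kernel hg.stronglyMeasurable).measurable
    · have : 0 ≤ 1 - ν.real Set.univ := by linarith
      calc _ = (1 - ν.real Set.univ) * (v - u) := by ring
        _ ≤ (1 - ν.real Set.univ) * (1 - ν.real Set.univ) ^ t := by gcongr
        _ = _ := by ring
    · have : IsProbabilityMeasure ((R b).map s) := Measure.isProbabilityMeasure_map hs.aemeasurable
      exact integral_mem_Icc_of_le (hν b) hg (fun b => (hb b).1) (fun b => (hb b).2)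
    · intro θ
      beta_reduce
      rw [integral_map hs.aemeasurable hg.aestronglyMeasurable]
      simp_rw [← hP]
      have hM := isMarkovKernel_pow (R.comap s hs) (t + 1)
      rw [Measure.real, add_comm (t + 1) 1, Kernel.pow_add_apply_eq_lintegral _ 1 (t + 1) _ hA, pow_one,
        ← Kernel.comap_apply R hs]
      simp only [Measure.real]
      rw [integral_toReal (Kernel.measurable_coe _ hA).aemeasurable
        (.of_forall fun x => measure_lt_top _ _)]

/-- Doeblin's criterion, for a transition that depends on the current state only through
`s θ`. -/
theorem uniformlyErgodic_of_minorization {R : Kernel B Θ} [IsMarkovKernel R] {s : Θ → B}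
    (hs : Measurable s) {ν : Measure B} (hν0 : ν ≠ 0) (hν : ∀ b, ν ≤ (R b).map s)
    {π : Measure Θ} [IsProbabilityMeasure π] (hπ : π.bind (R.comap s hs) = π)
    {step : Θ → Measure Θ} (hstep : ∀ θ, R (s θ) = step θ) :
    UniformlyErgodic step π := by
  have hΘ : Nonempty Θ := nonempty_of_isProbabilityMeasure π
  have hν1 : ν Set.univ ≤ 1 := by
    obtain ⟨θ⟩ := hΘ
    have : IsProbabilityMeasure ((R (s θ)).map s) :=
      Measure.isProbabilityMeasure_map hs.aemeasurable
    exact (hν (s θ) _).trans prob_le_one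
  have hfin : IsFiniteMeasure ν := ⟨hν1.trans_lt ENNReal.one_lt_top⟩
  have hν1' : ν.real Set.univ ≤ 1 := ENNReal.toReal_mono ENNReal.one_ne_top hν1
  have hνpos : 0 < ν.real Set.univ :=
    ENNReal.toReal_pos (by simpa using hν0) (measure_ne_top _ _)
  set δ := ν.real Set.univ
  -- The rate is 1 - δ/2 rather than 1 - δ so that it stays positive when δ = 1; its inverse as the
  -- constant M absorbs the lag of one in the exponent.
  refine ⟨inferInstance, R.comap s hs, inferInstance, fun θ => by
    rw [Kernel.comap_apply, hstep], (1 - δ / 2)⁻¹, inv_pos.2 (by linarith), 1 - δ / 2,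
    by linarith, by linarith, ?_⟩
  intro t ht θ
  obtain ⟨t, rfl⟩ : ∃ k, t = k + 1 := ⟨t - 1, by omega⟩
  have hinv : ∀ k : ℕ, π.bind ⇑((R.comap s hs) ^ k : Kernel Θ Θ) = π := by
    intro k
    induction k with
    | zero => exact Measure.id_comp
    | succ k ih => rw [pow_succ]; exact (Measure.comp_assoc).symm.trans (by rw [hπ, ih])
  have hρ : (1 - δ / 2)⁻¹ * (1 - δ / 2) ^ (t + 1) = (1 - δ / 2) ^ t := by
    rw [pow_succ', inv_mul_cancel_left₀ (by linarith)]
  rw [hρ]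
  have : (1 - δ) ^ t ≤ (1 - δ / 2) ^ t := pow_le_pow_left₀ (by linarith) (by linarith) _
  refine (ciSup_le fun A => ?_ : _ ≤ (1 - δ) ^ t).trans this
  obtain ⟨g, hg, ⟨u, v, huv, hb⟩, hP⟩ := exists_Icc_pow_of_minorization hs hν hν1' A.2 t
  -- By invariance π(A) is a π-average of the (t+1)-step probabilities, so it lies in the same
  -- interval [u, v] as each of them.
  have hπA : π.real A.1 = ∫ x, g (s x) ∂π := by
    conv_lhs => rw [← hinv (t + 1)]
    rw [Measure.real, Measure.bind_apply A.2 (Kernel.aemeasurable _), ← integral_toReal]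
    · exact integral_congr_ae (.of_forall hP)
    · exact (Kernel.measurable_coe _ A.2).aemeasurable
    · refine .of_forall fun x => ?_
      have hM := isMarkovKernel_pow (R.comap s hs) (t + 1)
      exact measure_lt_top _ _
  have hint : Integrable (fun x => g (s x)) π :=
    Integrable.of_mem_Icc u v (hg.comp hs).aemeasurable (.of_forall fun x => hb _)
  have h1 : u ≤ ∫ x, g (s x) ∂π := by
    simpa using integral_mono (integrable_const u) hint fun x => (hb (s x)).1
  have h2 : ∫ x, g (s x) ∂π ≤ v := by
    simpa using integral_mono hint (integrable_const v) fun x => (hb (s x)).2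
  rw [hP, hπA, abs_le]
  have := hb (s θ)
  constructor <;> linarith [this.1, this.2]

end Doeblin

/-! ### Two-block Gibbs samplers given by a joint density. -/

section TwoBlock

variable {A B : Type*} [MeasurableSpace A] [MeasurableSpace B]

lemma normalize_withDensity_apply (μ : Measure A) (f : A → ℝ≥0∞) {s : Set A}
    (hs : MeasurableSet s) :
    normalize (μ.withDensity f) s = (∫⁻ a, f a ∂μ)⁻¹ * ∫⁻ a in s, f a ∂μ := by
  simp [normalize, withDensity_apply _ hs]

lemma isProbabilityMeasure_normalize {μ : Measure A} (h0 : μ Set.univ ≠ 0)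
    (h1 : μ Set.univ ≠ ∞) : IsProbabilityMeasure (normalize μ) :=
  ⟨by simp [normalize, ENNReal.inv_mul_cancel h0 h1]⟩

lemma normalize_eq_self {μ : Measure A} [IsProbabilityMeasure μ] : normalize μ = μ := by
  simp [normalize]

lemma normalize_smul {μ : Measure A} {c : ℝ≥0∞} (h0 : c ≠ 0) (h1 : c ≠ ∞) :
    normalize (c • μ) = normalize μ := by
  simp only [normalize, Measure.smul_apply, smul_eq_mul, smul_smul]
  rw [ENNReal.mul_inv (.inl h0) (.inl h1), mul_right_comm, ENNReal.inv_mul_cancel h0 h1, one_mul]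

/-- The kernel that normalizes the density `f · b` for each `b`. -/
noncomputable def densityKernel (μ : Measure A) [SFinite μ] (f : B → A → ℝ≥0∞)
    (hf : Measurable (Function.uncurry f)) : Kernel B A where
  toFun b := normalize (μ.withDensity (f b))
  measurable' := by
    refine Measure.measurable_of_measurable_coe _ fun s hs => ?_
    simp_rw [normalize_withDensity_apply _ _ hs]
    exact (hf.lintegral_prod_right (ν := μ)).inv.mul (hf.lintegral_prod_right (ν := μ.restrict s))

/-- Disintegration of a joint density: the marginal density contains the normalizing constant that
the conditional law divides by. It is applied in both orders of the two blocks. -/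
lemma compProd_densityKernel {μA : Measure A} {μB : Measure B} [SFinite μA] [SFinite μB]
    {f : A → B → ℝ≥0∞} (hf : Measurable (Function.uncurry f)) {c : A → ℝ≥0∞} (hc : Measurable c)
    (h0 : ∀ a, ∫⁻ b, f a b ∂μB ≠ 0) (h1 : ∀ a, ∫⁻ b, f a b ∂μB ≠ ∞)
    [IsMarkovKernel (densityKernel μB f hf)]
    [SFinite (μA.withDensity fun a => c a * ∫⁻ b, f a b ∂μB)] :
    (μA.withDensity fun a => c a * ∫⁻ b, f a b ∂μB) ⊗ₘ (densityKernel μB f hf) =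
      (μA.prod μB).withDensity fun x => c x.1 * f x.1 x.2 := by
  ext s hs
  have hm : Measurable fun a => ∫⁻ b, f a b ∂μB := hf.lintegral_prod_right
  have hlw : ∀ F : A → ℝ≥0∞, Measurable F →
      ∫⁻ a, F a ∂(μA.withDensity fun a => c a * ∫⁻ b, f a b ∂μB) =
        ∫⁻ a, (c a * ∫⁻ b, f a b ∂μB) * F a ∂μA := fun F hF =>
    lintegral_withDensity_eq_lintegral_mul _ (hc.mul hm) hF
  rw [Measure.compProd_apply hs, hlw _ (Kernel.measurable_kernel_prodMk_left hs),
    withDensity_apply _ hs,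
    ← lintegral_indicator hs, lintegral_prod _ (by
      refine (Measurable.indicator ?_ hs).aemeasurable
      exact (hc.comp measurable_fst).mul hf)]
  refine lintegral_congr fun a => ?_
  have hsa : MeasurableSet (Prod.mk a ⁻¹' s) := measurable_prodMk_left hs
  have hfa : Measurable (f a) := hf.of_uncurry_left
  change c a * (∫⁻ b, f a b ∂μB) * normalize (μB.withDensity (f a)) _ = _
  rw [normalize_withDensity_apply _ _ hsa, mul_assoc, ← mul_assoc (∫⁻ b, f a b ∂μB),
    ENNReal.mul_inv_cancel (h0 a) (h1 a), one_mul, ← lintegral_indicator hsa,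
    ← lintegral_const_mul _ (hfa.indicator hsa)]
  refine lintegral_congr fun b => ?_
  by_cases h : (a, b) ∈ s <;> simp [Set.indicator, h]

/-- A two-block Gibbs sampler whose updates are the conditional laws of a joint density
`c a * g a b` is uniformly ergodic as soon as the marginal chain of the second block is
minorized. -/
theorem uniformlyErgodic_gibbs {μA : Measure A} {μB : Measure B} [SFinite μA]
    [SFinite μB] (hμB : μB ≠ 0) {c : A → ℝ≥0∞} (hc : Measurable c) {g : A → B → ℝ≥0∞}
    (hg : Measurable (Function.uncurry g)) {upd₁ : B → Measure A} {upd₂ : A → Measure B}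
    (h₂ : ∀ a, upd₂ a = normalize (μB.withDensity (g a)))
    (h₂0 : ∀ a, ∫⁻ b, g a b ∂μB ≠ 0) (h₂1 : ∀ a, ∫⁻ b, g a b ∂μB ≠ ∞)
    (h₁ : ∀ b, upd₁ b = normalize (μA.withDensity fun a => c a * g a b))
    (h₁0 : ∀ b, ∫⁻ a, c a * g a b ∂μA ≠ 0) (h₁1 : ∀ b, ∫⁻ a, c a * g a b ∂μA ≠ ∞)
    (htot : ∫⁻ a, c a * ∫⁻ b, g a b ∂μB ∂μA ≠ ∞)
    {ν : Measure B} (hν0 : ν ≠ 0) (hν : ∀ b, ν ≤ gibbsMarginal upd₁ upd₂ b) :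
    UniformlyErgodic (gibbsCycle upd₁ upd₂)
      (normalize ((μA.prod μB).withDensity fun x => c x.1 * g x.1 x.2)) ∧
    UniformlyErgodic (gibbsMarginal upd₁ upd₂)
      ((normalize ((μA.prod μB).withDensity fun x => c x.1 * g x.1 x.2)).map Prod.snd) := by
  set U := (μA.prod μB).withDensity fun x => c x.1 * g x.1 x.2 with hU
  have hf : Measurable (Function.uncurry fun b a => c a * g a b) :=
    (hc.comp measurable_snd).mul (hg.comp measurable_swap)
  set K₂ := densityKernel μB g hg with hK₂
  set K₁ := densityKernel μA (fun b a => c a * g a b) hf with hK₁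
  have hK₂a : ∀ a, K₂ a = upd₂ a := fun a => (h₂ a).symm
  have hK₁b : ∀ b, K₁ b = upd₁ b := fun b => (h₁ b).symm
  have hM₂ : IsMarkovKernel K₂ := ⟨fun a => isProbabilityMeasure_normalize
    (by simpa using h₂0 a) (by simpa using h₂1 a)⟩
  have hM₁ : IsMarkovKernel K₁ := ⟨fun b => isProbabilityMeasure_normalize
    (by simpa using h₁0 b) (by simpa using h₁1 b)⟩
  have hgm : Measurable fun a => ∫⁻ b, g a b ∂μB := hg.lintegral_prod_right
  have hfm : Measurable fun b => ∫⁻ a, c a * g a b ∂μA := hf.lintegral_prod_right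
  -- UA and UB are the two marginals of the joint measure U. Disintegrating U both ways shows that
  -- K₁ sends UB to UA and K₂ sends UA to UB, which gives invariance of U and of its second
  -- marginal.
  set UA := μA.withDensity fun a => c a * ∫⁻ b, g a b ∂μB with hUA
  set UB := μB.withDensity fun b => 1 * ∫⁻ a, c a * g a b ∂μA with hUB
  have hAfin : IsFiniteMeasure UA := isFiniteMeasure_withDensity htot
  have hUA2 : UA ⊗ₘ K₂ = U := compProd_densityKernel hg hc h₂0 h₂1
  have hUfst : U.fst = UA := by rw [← hUA2, Measure.fst_compProd]
  have hUfin : IsFiniteMeasure U := by rw [← hUA2]; infer_instance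
  have hUmass : U Set.univ = UB Set.univ := by
    rw [hU, hUB, withDensity_apply _ .univ, withDensity_apply _ .univ, Measure.restrict_univ,
      Measure.restrict_univ, lintegral_prod_symm _ (by
        exact ((hc.comp measurable_fst).mul hg).aemeasurable)]
    simp
  have hBfin : IsFiniteMeasure UB := ⟨by rw [← hUmass]; exact measure_lt_top _ _⟩
  have hUB1 : UB ⊗ₘ K₁ = U.map Prod.swap := by
    rw [hUB, compProd_densityKernel hf measurable_const h₁0 h₁1, hU]
    ext s hs
    rw [Measure.map_apply measurable_swap hs, withDensity_apply _ hs,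
      withDensity_apply _ (measurable_swap hs), ← Measure.prod_swap,
      Measure.restrict_map measurable_swap hs, lintegral_map (by
        exact (hf.const_mul 1)) measurable_swap]
    simp
  have hUsnd : U.snd = UB := by
    rw [← Measure.fst_compProd UB K₁, hUB1, Measure.fst_map_swap]
  have hK₁UB : K₁ ∘ₘ UB = UA := by
    rw [← Measure.snd_compProd, hUB1, Measure.snd_map_swap, hUfst]
  have hK₂UA : K₂ ∘ₘ UA = UB := by rw [← Measure.snd_compProd, hUA2, hUsnd]
  have hU0 : U Set.univ ≠ 0 := by
    rw [hUmass, hUB, withDensity_apply _ .univ, Measure.restrict_univ, Ne,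
      lintegral_eq_zero_iff (by simpa using hfm)]
    -- If U had mass zero, the marginal density on B would vanish almost everywhere, although it is
    -- nonzero everywhere and μB is not zero.
    intro h
    refine hμB (ae_eq_bot.1 ?_)
    have : ∀ᵐ b ∂μB, False := by
      filter_upwards [h] with b hb
      exact h₁0 b (by simpa using hb)
    simpa using this
  set Z := (U Set.univ)⁻¹ with hZ
  have hπ : normalize U = Z • U := rfl
  have hπprob : IsProbabilityMeasure (normalize U) :=
    isProbabilityMeasure_normalize hU0 (measure_ne_top _ _)
  have hmarg : ∀ b, (K₂ ∘ₖ K₁) b = gibbsMarginal upd₁ upd₂ b := by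
    intro b
    rw [Kernel.comp_apply, hK₁b, gibbsMarginal, funext hK₂a]
  have hcyc : ∀ b, ((Kernel.id ×ₖ K₂) ∘ₖ K₁) b = K₁ b ⊗ₘ K₂ := by
    intro b
    rw [Kernel.comp_apply, Measure.compProd_eq_comp_prod]
  constructor
  · refine uniformlyErgodic_of_minorization (R := (Kernel.id ×ₖ K₂) ∘ₖ K₁) measurable_snd hν0
      (fun b => ?_) ?_ (fun θ => ?_)
    · rw [hcyc]
      change ν ≤ (K₁ b ⊗ₘ K₂).snd
      rw [Measure.snd_compProd, ← Kernel.comp_apply, hmarg]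
      exact hν b
    · rw [hπ, Measure.comp_smul]
      congr 1
      -- The cycle forgets the first block, so only the second marginal UB of U enters; K₁ carries
      -- it to UA, and attaching K₂ rebuilds U.
      have : (((Kernel.id ×ₖ K₂) ∘ₖ K₁).comap Prod.snd measurable_snd : Kernel (A × B) (A × B))
            ∘ₘ U =
          ((Kernel.id ×ₖ K₂) ∘ₖ K₁) ∘ₘ U.snd := by
        rw [Measure.snd, ← Measure.deterministic_comp_eq_map measurable_snd, Measure.comp_assoc,
          Kernel.comp_deterministic_eq_comap]
      rw [this, hUsnd, ← Measure.comp_assoc, hK₁UB, ← Measure.compProd_eq_comp_prod, hUA2]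
    · rw [Kernel.comp_apply, hK₁b, gibbsCycle]
      congr 1
      ext1 a
      rw [Kernel.prod_apply, Kernel.id_apply, hK₂a]
  · have hp : IsProbabilityMeasure ((normalize U).map Prod.snd) :=
      Measure.isProbabilityMeasure_map measurable_snd.aemeasurable
    refine uniformlyErgodic_of_minorization (R := K₂ ∘ₖ K₁) measurable_id hν0
      (fun b => ?_) ?_ (fun b => hmarg b)
    · rw [Measure.map_id, hmarg]; exact hν b
    · have : (normalize U).map Prod.snd = Z • UB := by
        rw [hπ, Measure.map_smul, ← hUsnd, Measure.snd]
      rw [this, Measure.comp_smul]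
      congr 1
      rw [Kernel.comap_id, ← Measure.comp_assoc, hK₁UB, hK₂UA]

end TwoBlock

/-! ### Uniqueness of Laplace transforms on the half-line. -/

section Laplace

open Filter Topology

/-- A finite measure on the nonnegative reals is determined by its Laplace transform. -/
theorem ext_of_laplace {μ ν : Measure ℝ} [IsFiniteMeasure μ] [IsFiniteMeasure ν]
    (hμ : ∀ᵐ x ∂μ, 0 ≤ x) (hν : ∀ᵐ x ∂ν, 0 ≤ x)
    (h : ∀ s : ℝ, 0 ≤ s → ∫⁻ x, ENNReal.ofReal (Real.exp (-s * x)) ∂μ =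
      ∫⁻ x, ENNReal.ofReal (Real.exp (-s * x)) ∂ν) : μ = ν := by
  have hint : ∀ κ : Measure ℝ, IsFiniteMeasure κ → (∀ᵐ x ∂κ, 0 ≤ x) → ∀ t : ℝ, t ≤ 0 →
      Integrable (fun x => Real.exp (t * id x)) κ := by
    intro κ _ hκ t ht
    refine Integrable.of_mem_Icc 0 1 (by fun_prop) ?_
    filter_upwards [hκ] with x hx
    exact ⟨(Real.exp_pos _).le, Real.exp_le_one_iff.2 (mul_nonpos_of_nonpos_of_nonneg ht hx)⟩
  have hsub : ∀ κ : Measure ℝ, IsFiniteMeasure κ → (∀ᵐ x ∂κ, 0 ≤ x) →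
      {z : ℂ | z.re < 0} ⊆ {z : ℂ | z.re ∈ interior (integrableExpSet id κ)} := by
    intro κ hκf hκ z hz
    have : Set.Iio (0 : ℝ) ⊆ interior (integrableExpSet id κ) :=
      interior_maximal (fun t ht => hint κ hκf hκ t (le_of_lt ht)) isOpen_Iio
    exact this hz
  have hreal : ∀ t : ℝ, t ≤ 0 → complexMGF id μ t = complexMGF id ν t := by
    intro t ht
    rw [complexMGF_ofReal, complexMGF_ofReal]
    congr 1
    have := congrArg ENNReal.toReal (h (-t) (by linarith))
    rw [← integral_toReal (by fun_prop) (by simp), ← integral_toReal (by fun_prop) (by simp)]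
      at this
    simpa [mgf, ENNReal.toReal_ofReal (Real.exp_pos _).le] using this
  have hconn : IsPreconnected {z : ℂ | z.re < 0} :=
    ((convex_Iio (0 : ℝ)).linear_preimage Complex.reLm).isPreconnected
  -- Both transforms are analytic on the open left half-plane and agree on the negative real axis,
  -- which accumulates at -1; the identity theorem applies.
  have heq : Set.EqOn (complexMGF id μ) (complexMGF id ν) {z : ℂ | z.re < 0} := by
    refine AnalyticOnNhd.eqOn_of_preconnected_of_frequently_eq
      (analyticOnNhd_complexMGF.mono (hsub μ inferInstance hμ))
      (analyticOnNhd_complexMGF.mono (hsub ν inferInstance hν)) hconn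
      (z₀ := ((-1 : ℝ) : ℂ)) (by simp) ?_
    have h_real : ∃ᶠ x : ℝ in 𝓝[≠] (-1), complexMGF id μ x = complexMGF id ν x := by
      refine Eventually.frequently ?_
      filter_upwards [nhdsWithin_le_nhds (Iio_mem_nhds (by norm_num : (-1 : ℝ) < 0))] with x hx
      exact hreal x (le_of_lt hx)
    rw [frequently_iff_seq_forall] at h_real ⊢
    obtain ⟨xs, hx_tendsto, hx_eq⟩ := h_real
    refine ⟨fun n => xs n, ?_, fun n => by simp [hx_eq]⟩
    rw [tendsto_nhdsWithin_iff] at hx_tendsto ⊢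
    exact ⟨(Complex.continuous_ofReal.tendsto _).comp hx_tendsto.1, by
      filter_upwards [hx_tendsto.2] with n hn
      simpa only [Set.mem_compl_iff, Set.mem_singleton_iff, Complex.ofReal_inj] using hn⟩
  have hre : ∀ (n : ℕ) (t : ℝ),
      (-(1 / ((n : ℝ) + 1) : ℝ) + t * Complex.I : ℂ).re = -(1 / ((n : ℝ) + 1)) := fun n t => by
    rw [Complex.add_re, Complex.neg_re, Complex.ofReal_re]
    simp
  -- The imaginary axis is only the boundary of the half-plane. It is reached from the left along
  -- -1/(n+1) + it by dominated convergence, since the exponentials are bounded by 1 on x ≥ 0. This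
  -- yields the characteristic functions.
  have hlim : ∀ κ : Measure ℝ, IsFiniteMeasure κ → (∀ᵐ x ∂κ, 0 ≤ x) → ∀ t : ℝ,
      Tendsto (fun n : ℕ => complexMGF id κ (-(1 / ((n : ℝ) + 1) : ℝ) + t * Complex.I)) atTop
        (𝓝 (charFun κ t)) := by
    intro κ _ hκ t
    rw [← complexMGF_id_mul_I]
    refine tendsto_integral_of_dominated_convergence (fun _ => (1 : ℝ)) (fun n => ?_)
      (integrable_const _) (fun n => ?_) (.of_forall fun x => ?_)
    · exact Measurable.aestronglyMeasurable (by fun_prop)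
    · filter_upwards [hκ] with x hx
      rw [Complex.norm_exp]
      refine Real.exp_le_one_iff.2 ?_
      have : (0 : ℝ) ≤ 1 / ((n : ℝ) + 1) * x := by positivity
      rw [id, Complex.re_mul_ofReal, hre]
      linarith
    · refine (Complex.continuous_exp.tendsto _).comp ?_
      refine Tendsto.mul_const _ ?_
      have h0 : Tendsto (fun n : ℕ => ((-(1 / ((n : ℝ) + 1) : ℝ) : ℝ) : ℂ)) atTop
          (𝓝 ((-0 : ℝ) : ℂ)) :=
        (Complex.continuous_ofReal.tendsto _).comp tendsto_one_div_add_atTop_nhds_zero_nat.neg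
      simpa using h0.add_const (t * Complex.I)
  refine Measure.ext_of_charFun (funext fun t => ?_)
  refine tendsto_nhds_unique (hlim μ inferInstance hμ t) ?_
  refine (hlim ν inferInstance hν t).congr fun n => (heq ?_).symm
  have : (0 : ℝ) < 1 / ((n : ℝ) + 1) := by positivity
  rw [Set.mem_ofPred_eq, hre]
  linarith

end Laplace

/-! ### Laplace transform and mean of the gamma law. -/

section Gamma

lemma gammaMeasure_ae_pos (b : ℝ) : ∀ᵐ x ∂gammaMeasure b 1, 0 < x := by
  rw [gammaMeasure, ae_withDensity_iff (by unfold gammaPDF; fun_prop)]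
  filter_upwards [Measure.ae_ne volume (0 : ℝ)] with x hx0 hx
  by_contra hneg
  exact hx (gammaPDF_of_neg (lt_of_le_of_ne (not_lt.1 hneg) hx0))

lemma lintegral_exp_gammaMeasure {b : ℝ} (hb : 0 < b) {r : ℝ} (hr : -1 < r) :
    ∫⁻ x, ENNReal.ofReal (Real.exp (-r * x)) ∂gammaMeasure b 1 =
      ENNReal.ofReal ((1 + r) ^ (-b)) := by
  have hr' : 0 < 1 + r := by linarith
  have hm : ∀ r, Measurable (gammaPDF b r) := fun r => by unfold gammaPDF; fun_prop
  rw [gammaMeasure, lintegral_withDensity_eq_lintegral_mul _ (hm 1) (by fun_prop)]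
  have : ∀ x, (gammaPDF b 1 * fun x => ENNReal.ofReal (Real.exp (-r * x))) x =
      ENNReal.ofReal ((1 + r) ^ (-b)) * gammaPDF b (1 + r) x := by
    intro x
    rcases lt_or_ge x 0 with hx | hx
    · simp [gammaPDF_of_neg hx]
    · rw [Pi.mul_apply, gammaPDF_of_nonneg hx, gammaPDF_of_nonneg hx,
        ← ENNReal.ofReal_mul (by positivity), ← ENNReal.ofReal_mul (by positivity)]
      congr 1
      rw [Real.rpow_neg hr'.le, Real.one_rpow, show -((1 + r) * x) = -(1 * x) + -r * x by ring,
        Real.exp_add]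
      have := (Real.rpow_pos_of_pos hr' b).ne'
      field_simp
  simp_rw [this]
  rw [lintegral_const_mul _ (hm _), lintegral_gammaPDF_eq_one hb hr', mul_one]

lemma lintegral_id_gammaMeasure_ne_top {b : ℝ} (hb : 0 < b) :
    ∫⁻ x, ENNReal.ofReal x ∂gammaMeasure b 1 ≠ ∞ := by
  -- The mean is finite because x ≤ 2 exp(x/2), and the Laplace formula is valid at r = -1/2 > -1.
  refine ne_top_of_le_ne_top (b := ∫⁻ x, 2 * ENNReal.ofReal (Real.exp (-(-(1 / 2)) * x))
    ∂gammaMeasure b 1) ?_ (lintegral_mono fun x => ?_)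
  · rw [lintegral_const_mul _ (by fun_prop), lintegral_exp_gammaMeasure hb (by norm_num)]
    exact ENNReal.mul_ne_top (by simp) ENNReal.ofReal_ne_top
  · rw [show (2 : ℝ≥0∞) = ENNReal.ofReal 2 by simp, ← ENNReal.ofReal_mul (by norm_num)]
    refine ENNReal.ofReal_le_ofReal ?_
    have := Real.add_one_le_exp (1 / 2 * x)
    rw [neg_neg]
    linarith

end Gamma

/-! ### The Kolmogorov-Gamma series and its Laplace transform. -/

section KolmogorovGamma

open Filter Topology

/-- The law of the i.i.d. gamma variables in the Kolmogorov-Gamma series. -/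
noncomputable def gammaSeq (b : ℝ) : Measure (ℕ → ℝ) :=
  Measure.infinitePi fun _ : ℕ => gammaMeasure b 1

/-- The coefficient of the `k`-th gamma variable in the Kolmogorov-Gamma series. -/
noncomputable def kgCoeff (c : ℝ) (k : ℕ) : ℝ :=
  1 / (2 * Real.pi ^ 2) * (1 / (((k : ℝ) + 1) ^ 2 + c ^ 2 / (4 * Real.pi ^ 2)))

lemma kgCoeff_pos (c : ℝ) (k : ℕ) : 0 < kgCoeff c k := by unfold kgCoeff; positivity

lemma kgCoeff_le (c : ℝ) (k : ℕ) : kgCoeff c k ≤ kgCoeff 0 k := by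
  have h : (0 : ℝ) ≤ c ^ 2 / (4 * Real.pi ^ 2) := by positivity
  refine mul_le_mul_of_nonneg_left (one_div_le_one_div_of_le (by positivity) ?_) (by positivity)
  simpa using h

/-- The Kolmogorov-Gamma series. -/
noncomputable def kgSeries (c : ℝ) (ε : ℕ → ℝ) : ℝ := ∑' k, ε k * kgCoeff c k

lemma kg_eq_map (b c : ℝ) : kg b c = (gammaSeq b).map (kgSeries c) := by
  unfold kg gammaSeq
  congr 1
  funext ε
  rw [kgSeries, ← tsum_mul_left]
  refine tsum_congr fun k => ?_
  unfold kgCoeff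
  ring

lemma measurable_kgSeries (c : ℝ) : Measurable (kgSeries c) :=
  Measurable.tsum fun k => (measurable_pi_apply k).mul_const _

variable {b : ℝ}

lemma isProbabilityMeasure_gammaSeq (hb : 0 < b) : IsProbabilityMeasure (gammaSeq b) := by
  have : IsProbabilityMeasure (gammaMeasure b 1) := isProbabilityMeasure_gammaMeasure hb one_pos
  unfold gammaSeq; infer_instance

lemma lintegral_gammaSeq_eval (hb : 0 < b) (k : ℕ) {f : ℝ → ℝ≥0∞} (hf : Measurable f) :
    ∫⁻ ε, f (ε k) ∂gammaSeq b = ∫⁻ x, f x ∂gammaMeasure b 1 := by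
  have : IsProbabilityMeasure (gammaMeasure b 1) := isProbabilityMeasure_gammaMeasure hb one_pos
  exact (measurePreserving_eval_infinitePi (fun _ : ℕ => gammaMeasure b 1) k).lintegral_comp hf

lemma gammaSeq_ae_pos (hb : 0 < b) : ∀ᵐ ε ∂gammaSeq b, ∀ k, 0 < ε k := by
  have : IsProbabilityMeasure (gammaMeasure b 1) := isProbabilityMeasure_gammaMeasure hb one_pos
  refine ae_all_iff.2 fun k => ?_
  exact (measurePreserving_eval_infinitePi
    (fun _ : ℕ => gammaMeasure b 1) k).quasiMeasurePreserving.ae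
    (gammaMeasure_ae_pos b)

lemma summable_kgCoeff (c : ℝ) : Summable (kgCoeff c) := by
  refine Summable.of_nonneg_of_le (fun k => (kgCoeff_pos c k).le) (kgCoeff_le c) ?_
  unfold kgCoeff
  refine Summable.mul_left _ ?_
  simpa using (summable_nat_add_iff 1).2 (Real.summable_one_div_nat_pow.2 one_lt_two)

/-- The expected sum is finite by Tonelli, as the coefficients are summable. A divergent `tsum`
would take the default value 0, so positivity and comparison of the series rest on this. -/
lemma gammaSeq_ae_summable (hb : 0 < b) (c : ℝ) :
    ∀ᵐ ε ∂gammaSeq b, Summable fun k => ε k * kgCoeff c k := by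
  have hfin : ∫⁻ ε, ∑' k, ENNReal.ofReal (ε k * kgCoeff c k) ∂gammaSeq b ≠ ∞ := by
    rw [lintegral_tsum fun k => Measurable.aemeasurable (by fun_prop)]
    have : ∀ k, ∫⁻ ε, ENNReal.ofReal (ε k * kgCoeff c k) ∂gammaSeq b =
        ENNReal.ofReal (kgCoeff c k) * ∫⁻ x, ENNReal.ofReal x ∂gammaMeasure b 1 := by
      intro k
      simp_rw [mul_comm _ (kgCoeff c k), ENNReal.ofReal_mul (kgCoeff_pos c k).le]
      rw [lintegral_const_mul _ (by fun_prop), lintegral_gammaSeq_eval hb k (by fun_prop)]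
    simp_rw [this]
    rw [ENNReal.tsum_mul_right]
    exact ENNReal.mul_ne_top (summable_kgCoeff c).tsum_ofReal_ne_top
      (lintegral_id_gammaMeasure_ne_top hb)
  filter_upwards [ae_lt_top' (AEMeasurable.tsum fun k => Measurable.aemeasurable (by fun_prop)) hfin,
    gammaSeq_ae_pos hb]
    with ε hε hpos
  have := ENNReal.summable_toReal hε.ne
  refine this.congr fun k => ?_
  rw [ENNReal.toReal_ofReal (mul_nonneg (hpos k).le (kgCoeff_pos c k).le)]

lemma gammaSeq_ae_kgSeries_pos (hb : 0 < b) (c : ℝ) : ∀ᵐ ε ∂gammaSeq b, 0 < kgSeries c ε := by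
  filter_upwards [gammaSeq_ae_pos hb, gammaSeq_ae_summable hb c] with ε hpos hsum
  exact hsum.tsum_pos (fun k => (mul_pos (hpos k) (kgCoeff_pos c k)).le) 0
    (mul_pos (hpos 0) (kgCoeff_pos c 0))

/-- Coupling: the same gamma variables drive both series, and the coefficients decrease as c² grows.
This monotonicity makes the minorization uniform in the current state. -/
lemma gammaSeq_ae_kgSeries_le (hb : 0 < b) (c : ℝ) :
    ∀ᵐ ε ∂gammaSeq b, kgSeries c ε ≤ kgSeries 0 ε := by
  filter_upwards [gammaSeq_ae_pos hb, gammaSeq_ae_summable hb c, gammaSeq_ae_summable hb 0]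
    with ε hpos h1 h2
  exact h1.tsum_le_tsum (fun k => mul_le_mul_of_nonneg_left (kgCoeff_le c k) (hpos k).le) h2

/-- Independence factors the transform of each partial sum; dominated convergence passes to the full
series. -/
lemma tendsto_laplace_kgSeries (hb : 0 < b) (c : ℝ) {s : ℝ} (hs : 0 ≤ s) :
    Tendsto (fun N => ∏ k ∈ Finset.range N, ENNReal.ofReal ((1 + s * kgCoeff c k) ^ (-b))) atTop
      (𝓝 (∫⁻ ε, ENNReal.ofReal (Real.exp (-s * kgSeries c ε)) ∂gammaSeq b)) := by
  have hP := isProbabilityMeasure_gammaSeq hb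
  have hG : IsProbabilityMeasure (gammaMeasure b 1) := isProbabilityMeasure_gammaMeasure hb one_pos
  have hprod : ∀ N, ∏ k ∈ Finset.range N, ENNReal.ofReal ((1 + s * kgCoeff c k) ^ (-b)) =
      ∫⁻ ε, ENNReal.ofReal (Real.exp (-s * ∑ k ∈ Finset.range N, ε k * kgCoeff c k))
        ∂gammaSeq b := by
    intro N
    have hind : iIndepFun (fun k (ε : ℕ → ℝ) =>
        ENNReal.ofReal (Real.exp (-(s * kgCoeff c k) * ε k))) (gammaSeq b) :=
      iIndepFun_infinitePi (P := fun _ : ℕ => gammaMeasure b 1)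
        (X := fun k x => ENNReal.ofReal (Real.exp (-(s * kgCoeff c k) * x)))
        (fun k => by fun_prop)
    have h1 := lintegral_prod_eq_prod_lintegral_of_indepFun (Finset.range N) _ hind
      (fun k => by fun_prop)
    have h2 : ∀ k, ∫⁻ ε, ENNReal.ofReal (Real.exp (-(s * kgCoeff c k) * ε k)) ∂gammaSeq b =
        ENNReal.ofReal ((1 + s * kgCoeff c k) ^ (-b)) := fun k => by
      rw [lintegral_gammaSeq_eval hb k
        (f := fun x => ENNReal.ofReal (Real.exp (-(s * kgCoeff c k) * x))) (by fun_prop),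
        lintegral_exp_gammaMeasure hb]
      linarith [mul_nonneg hs (kgCoeff_pos c k).le]
    rw [Finset.prod_congr rfl fun k _ => (h2 k).symm, ← h1]
    refine lintegral_congr fun ε => ?_
    rw [← ENNReal.ofReal_prod_of_nonneg fun k _ => (Real.exp_pos _).le, ← Real.exp_sum,
      Finset.mul_sum]
    congr 2
    exact Finset.sum_congr rfl fun k _ => by ring
  simp_rw [hprod]
  refine tendsto_lintegral_of_dominated_convergence' (fun _ => 1)
    (fun N => Measurable.aemeasurable (by fun_prop))
    (fun N => ?_) (by simp) ?_
  · filter_upwards [gammaSeq_ae_pos hb] with ε hpos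
    rw [ENNReal.ofReal_le_one, Real.exp_le_one_iff]
    exact mul_nonpos_of_nonpos_of_nonneg (by linarith)
      (Finset.sum_nonneg fun k _ => (mul_pos (hpos k) (kgCoeff_pos c k)).le)
  · filter_upwards [gammaSeq_ae_summable hb c] with ε hsum
    refine (ENNReal.continuous_ofReal.tendsto _).comp ((Real.continuous_exp.tendsto _).comp ?_)
    exact (hsum.hasSum.tendsto_sum_nat).const_mul _

/-- The Laplace transform of `KG(b, 0)`, at `c² / 2`. -/
noncomputable def kgTilt (b c : ℝ) : ℝ≥0∞ :=
  ∫⁻ ε, ENNReal.ofReal (Real.exp (-(c ^ 2 / 2) * kgSeries 0 ε)) ∂gammaSeq b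

lemma lintegral_exp_kgSeries_le_one (hb : 0 < b) (c : ℝ) {s : ℝ} (hs : 0 ≤ s) :
    ∫⁻ ε, ENNReal.ofReal (Real.exp (-s * kgSeries c ε)) ∂gammaSeq b ≤ 1 := by
  have hP := isProbabilityMeasure_gammaSeq hb
  calc _ ≤ ∫⁻ _, 1 ∂gammaSeq b := lintegral_mono_ae <| by
        filter_upwards [gammaSeq_ae_kgSeries_pos hb c] with ε hε
        rw [ENNReal.ofReal_le_one, Real.exp_le_one_iff]
        exact mul_nonpos_of_nonpos_of_nonneg (by linarith) hε.le
    _ = 1 := by simp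

lemma kgTilt_ne_top (hb : 0 < b) (c : ℝ) : kgTilt b c ≠ ∞ :=
  ((lintegral_exp_kgSeries_le_one hb 0 (by positivity)).trans_lt ENNReal.one_lt_top).ne

/-- Writing a_k(c) for `kgCoeff c k`, the products match factor by factor: 1 + (s + c²/2) a_k(0) =
(1 + (c²/2) a_k(0)) (1 + s a_k(c)). -/
lemma laplace_kgSeries_tilt (hb : 0 < b) (c : ℝ) {s : ℝ} (hs : 0 ≤ s) :
    ∫⁻ ε, ENNReal.ofReal (Real.exp (-(s + c ^ 2 / 2) * kgSeries 0 ε)) ∂gammaSeq b =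
      kgTilt b c * ∫⁻ ε, ENNReal.ofReal (Real.exp (-s * kgSeries c ε)) ∂gammaSeq b := by
  have h1 := tendsto_laplace_kgSeries hb 0 (s := s + c ^ 2 / 2) (by positivity)
  have h2 := tendsto_laplace_kgSeries hb 0 (s := c ^ 2 / 2) (by positivity)
  have h3 := tendsto_laplace_kgSeries hb c hs
  refine tendsto_nhds_unique h1 ((ENNReal.Tendsto.mul h2
    (.inr ((lintegral_exp_kgSeries_le_one hb c hs).trans_lt ENNReal.one_lt_top).ne) h3
    (.inr (kgTilt_ne_top hb c))).congr fun N => ?_)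
  rw [← Finset.prod_mul_distrib]
  refine Finset.prod_congr rfl fun k _ => ?_
  have hk := kgCoeff_pos 0 k
  have hk' := kgCoeff_pos c k
  rw [← ENNReal.ofReal_mul (by positivity), ← Real.mul_rpow (by positivity) (by positivity)]
  congr 2
  unfold kgCoeff
  have := Real.pi_ne_zero
  have h4 : ((k : ℝ) + 1) ^ 2 + c ^ 2 / (4 * Real.pi ^ 2) ≠ 0 := by positivity
  have h5 : ((k : ℝ) + 1) ≠ 0 := by positivity
  have h6 : ((k : ℝ) + 1) ^ 2 * (4 * Real.pi ^ 2) + c ^ 2 ≠ 0 := by positivity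
  field_simp
  ring

end KolmogorovGamma

/-! ### Exponential tilting and its normalizing constant. -/

section KolmogorovGamma

open Filter Topology

variable {b : ℝ}

/-- Euler's product for sin(πx)/(πx) at the imaginary point x = ic/(2π). -/
lemma tendsto_sinh_prod {c : ℝ} (hc : c ≠ 0) :
    Tendsto (fun N => ∏ k ∈ Finset.range N, (1 + c ^ 2 / 2 * kgCoeff 0 k)) atTop
      (𝓝 (Real.sinh (c / 2) / (c / 2))) := by
  have hπ := Real.pi_ne_zero
  have hx : (Complex.I * (c / (2 * Real.pi)) : ℂ) ≠ 0 := by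
    simp [hc, hπ]
  have h := tendsto_euler_sin_prod' hx
  have h1 : Complex.sin (Real.pi * (Complex.I * (c / (2 * Real.pi)))) /
      (Real.pi * (Complex.I * (c / (2 * Real.pi)))) = ((Real.sinh (c / 2) / (c / 2) : ℝ) : ℂ) := by
    have h2 : (Real.pi * (Complex.I * (c / (2 * Real.pi))) : ℂ) = (c / 2 : ℝ) * Complex.I := by
      have : (Real.pi : ℂ) ≠ 0 := by exact_mod_cast hπ
      push_cast
      field_simp
    rw [h2, Complex.sin_mul_I, ← Complex.ofReal_sinh, mul_div_mul_right _ _ Complex.I_ne_zero,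
      ← Complex.ofReal_div]
  rw [h1] at h
  have h3 := (Complex.continuous_re.tendsto _).comp h
  rw [Complex.ofReal_re] at h3
  refine h3.congr fun N => ?_
  have : ∏ k ∈ Finset.range N, (1 + sineTerm (Complex.I * (c / (2 * Real.pi)) : ℂ) k) =
      ((∏ k ∈ Finset.range N, (1 + c ^ 2 / 2 * kgCoeff 0 k) : ℝ) : ℂ) := by
    rw [Complex.ofReal_prod]
    refine Finset.prod_congr rfl fun k _ => ?_
    have h4 : ((k : ℂ) + 1) ≠ 0 := Nat.cast_add_one_ne_zero k
    have h5 : (Real.pi : ℂ) ≠ 0 := by exact_mod_cast hπ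
    simp only [sineTerm, kgCoeff, mul_pow, Complex.I_sq]
    push_cast
    field_simp
    ring
  rw [Function.comp_apply, this, Complex.ofReal_re]

lemma expDiv_pos (θ : ℝ) : 0 < expDiv θ := by
  unfold expDiv
  split_ifs with h
  · exact one_pos
  · rcases lt_or_gt_of_ne h with h | h
    · exact div_pos_of_neg_of_neg (by linarith [Real.exp_lt_exp.2 h, Real.exp_zero]) h
    · exact div_pos (by linarith [Real.one_lt_exp_iff.2 h]) h

lemma tendsto_expDiv_prod (c : ℝ) :
    Tendsto (fun N => ∏ k ∈ Finset.range N, (1 + c ^ 2 / 2 * kgCoeff 0 k)) atTop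
      (𝓝 (expDiv c * Real.exp (-(c / 2)))) := by
  rcases eq_or_ne c 0 with rfl | hc
  · simp [expDiv]
  · convert tendsto_sinh_prod hc using 2
    rw [expDiv, if_neg hc, Real.sinh_eq, sub_div, sub_mul, div_mul_eq_mul_div, ← Real.exp_add]
    have : c + -(c / 2) = c / 2 := by ring
    rw [this]
    field_simp

/-- The Laplace transform of `KG(b, 0)` at `c² / 2` is `((c / 2) / sinh (c / 2)) ^ b`. -/
lemma kgTilt_eq (hb : 0 < b) (c : ℝ) :
    kgTilt b c = ENNReal.ofReal ((expDiv c * Real.exp (-(c / 2))) ^ (-b)) := by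
  have h := tendsto_laplace_kgSeries hb 0 (s := c ^ 2 / 2) (by positivity)
  refine tendsto_nhds_unique h ?_
  have hpos : 0 < expDiv c * Real.exp (-(c / 2)) := mul_pos (expDiv_pos c) (Real.exp_pos _)
  refine ((ENNReal.continuous_ofReal.tendsto _).comp
    ((tendsto_expDiv_prod c).rpow_const (p := -b) (.inl hpos.ne'))).congr fun N => ?_
  have hk : ∀ k, 0 < 1 + c ^ 2 / 2 * kgCoeff 0 k := fun k => by
    have := kgCoeff_pos 0 k
    positivity
  rw [Function.comp_apply, ← Real.finsetProd_rpow _ _ fun k _ => (hk k).le,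
    ENNReal.ofReal_prod_of_nonneg fun k _ => Real.rpow_nonneg (hk k).le _]

lemma kgTilt_ne_zero (hb : 0 < b) (c : ℝ) : kgTilt b c ≠ 0 := by
  rw [kgTilt_eq hb, Ne, ENNReal.ofReal_eq_zero, not_le]
  exact Real.rpow_pos_of_pos (mul_pos (expDiv_pos c) (Real.exp_pos _)) _

/-- The augmented likelihood of one observation integrates to the cobin density. -/
lemma kgTilt_natCast_mul {l : ℕ} (hl : 1 ≤ l) (y c : ℝ) :
    ENNReal.ofReal (Real.exp (l * (y - 0.5) * c)) * kgTilt l c =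
      ENNReal.ofReal (Real.exp (l * c * y) / expDiv c ^ l) := by
  have hpos := expDiv_pos c
  rw [kgTilt_eq (by exact_mod_cast hl), ← ENNReal.ofReal_mul (Real.exp_pos _).le,
    Real.rpow_neg (by positivity), Real.rpow_natCast, mul_pow, mul_inv, ← Real.exp_nat_mul,
    ← Real.exp_neg, div_eq_mul_inv,
    show (l : ℝ) * c * y = l * (y - 0.5) * c + -(l * -(c / 2)) by ring, Real.exp_add]
  ring_nf

lemma kg_ae_pos (hb : 0 < b) (c : ℝ) : ∀ᵐ x ∂kg b c, 0 < x := by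
  rw [kg_eq_map, ae_map_iff (measurable_kgSeries c).aemeasurable measurableSet_Ioi]
  exact gammaSeq_ae_kgSeries_pos hb c

lemma isProbabilityMeasure_kg (hb : 0 < b) (c : ℝ) : IsProbabilityMeasure (kg b c) := by
  have := isProbabilityMeasure_gammaSeq hb
  rw [kg_eq_map]
  exact Measure.isProbabilityMeasure_map (measurable_kgSeries c).aemeasurable

lemma map_kgPos (hb : 0 < b) (c : ℝ) : (kgPos b c).map Subtype.val = kg b c := by
  rw [kgPos, map_comap_subtype_coe measurableSet_Ioi, Measure.restrict_eq_self_of_ae_mem]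
  exact kg_ae_pos hb c

lemma isProbabilityMeasure_kgPos (hb : 0 < b) (c : ℝ) : IsProbabilityMeasure (kgPos b c) := by
  have := isProbabilityMeasure_kg hb c
  refine ⟨?_⟩
  rw [← Set.preimage_univ (f := Subtype.val), ← Measure.map_apply measurable_subtype_coe .univ,
    map_kgPos hb, measure_univ]

lemma lintegral_kg (b c : ℝ) {f : ℝ → ℝ≥0∞} (hf : Measurable f) :
    ∫⁻ x, f x ∂kg b c = ∫⁻ ε, f (kgSeries c ε) ∂gammaSeq b := by
  rw [kg_eq_map, lintegral_map hf (measurable_kgSeries c)]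

lemma lintegral_kgPos (hb : 0 < b) (c : ℝ) {f : ℝ → ℝ≥0∞} (hf : Measurable f) :
    ∫⁻ x, f (x : ℝ) ∂kgPos b c = ∫⁻ ε, f (kgSeries c ε) ∂gammaSeq b := by
  rw [← lintegral_kg b c hf, ← map_kgPos hb, lintegral_map hf measurable_subtype_coe]

/-- `KG(b, c)` is an exponential tilting of `KG(b, 0)`. -/
lemma kg_withDensity (hb : 0 < b) (c : ℝ) :
    (kg b 0).withDensity (fun x => ENNReal.ofReal (Real.exp (-(x * c ^ 2 / 2)))) =
      kgTilt b c • kg b c := by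
  have h0 := isProbabilityMeasure_kg hb 0
  have hc := isProbabilityMeasure_kg hb c
  -- Both sides equal the Laplace transform of KG(b, 0) at s + c²/2.
  have hlap : ∀ s : ℝ, 0 ≤ s →
      ∫⁻ x, ENNReal.ofReal (Real.exp (-s * x)) ∂(kg b 0).withDensity
        (fun x => ENNReal.ofReal (Real.exp (-(x * c ^ 2 / 2)))) =
      ∫⁻ x, ENNReal.ofReal (Real.exp (-s * x)) ∂(kgTilt b c • kg b c) := by
    intro s hs
    rw [lintegral_withDensity_eq_lintegral_mul _ (by fun_prop) (by fun_prop),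
      lintegral_smul_measure, lintegral_kg b c (by fun_prop), smul_eq_mul,
      ← laplace_kgSeries_tilt hb c hs, ← lintegral_kg b 0
        (f := fun x => ENNReal.ofReal (Real.exp (-(s + c ^ 2 / 2) * x))) (by fun_prop)]
    refine lintegral_congr fun x => ?_
    rw [Pi.mul_apply, ← ENNReal.ofReal_mul (Real.exp_pos _).le, ← Real.exp_add]
    congr 2
    ring
  have hfin1 : IsFiniteMeasure (kgTilt b c • kg b c) :=
    ⟨by simpa using (kgTilt_ne_top hb c).lt_top⟩
  have hfin2 : IsFiniteMeasure ((kg b 0).withDensity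
      (fun x => ENNReal.ofReal (Real.exp (-(x * c ^ 2 / 2))))) :=
    ⟨by simpa using (hlap 0 le_rfl).trans_lt (by simpa using (kgTilt_ne_top hb c).lt_top)⟩
  refine ext_of_laplace ?_ ?_ hlap
  · exact (withDensity_absolutelyContinuous _ _).ae_le ((kg_ae_pos hb 0).mono fun x hx => hx.le)
  · exact Measure.ae_smul_measure ((kg_ae_pos hb c).mono fun x hx => hx.le) _

lemma kgPos_withDensity (hb : 0 < b) (c : ℝ) :
    (kgPos b 0).withDensity (fun x => ENNReal.ofReal (Real.exp (-((x : ℝ) * c ^ 2 / 2)))) =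
      kgTilt b c • kgPos b c := by
  ext s hs
  have hs' : MeasurableSet (Subtype.val '' s : Set ℝ) := measurableSet_Ioi.subtype_image hs
  have h := congrArg (fun μ : Measure ℝ => μ (Subtype.val '' s)) (kg_withDensity hb c)
  simp only [Measure.smul_apply, smul_eq_mul] at h
  rw [withDensity_apply _ hs', ← map_kgPos hb 0, ← map_kgPos hb c,
    Measure.restrict_map measurable_subtype_coe hs', lintegral_map (by fun_prop)
    measurable_subtype_coe, Measure.map_apply measurable_subtype_coe hs',
    Set.preimage_image_eq _ Subtype.val_injective] at h
  rw [withDensity_apply _ hs, h, Measure.smul_apply, smul_eq_mul]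

lemma kgTilt_eq_lintegral_kgPos (hb : 0 < b) (c : ℝ) :
    kgTilt b c = ∫⁻ x, ENNReal.ofReal (Real.exp (-((x : ℝ) * c ^ 2 / 2))) ∂kgPos b 0 := by
  have := isProbabilityMeasure_kgPos hb c
  have h := congrArg (fun μ => μ Set.univ) (kgPos_withDensity hb c)
  simpa using h.symm

/-- The Laplace transform of `KG(b, c)` is smallest for `c = 0`. -/
lemma kgTilt_le_lintegral_kgPos (hb : 0 < b) (c η : ℝ) :
    kgTilt b η ≤ ∫⁻ x, ENNReal.ofReal (Real.exp (-((x : ℝ) * η ^ 2 / 2))) ∂kgPos b c := by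
  rw [lintegral_kgPos hb c (f := fun x => ENNReal.ofReal (Real.exp (-(x * η ^ 2 / 2))))
    (by fun_prop), kgTilt]
  refine lintegral_mono_ae ?_
  filter_upwards [gammaSeq_ae_kgSeries_le hb c] with ε hε
  refine ENNReal.ofReal_le_ofReal (Real.exp_le_exp.2 ?_)
  nlinarith [mul_le_mul_of_nonneg_right hε (by positivity : 0 ≤ η ^ 2 / 2)]

end KolmogorovGamma

/-! ### Finite products of measures with densities. -/

section Product

/-- **Tonelli's theorem** for a product of functions of the coordinates. -/
lemma lintegral_fin_prod_eq_prod {n : ℕ} {E : Type*} {mE : MeasurableSpace E}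
    {μ : Fin n → Measure E} [∀ i, SigmaFinite (μ i)] {f : Fin n → E → ℝ≥0∞}
    (hf : ∀ i, Measurable (f i)) :
    ∫⁻ x : Fin n → E, ∏ i, f i (x i) ∂(Measure.pi μ) = ∏ i, ∫⁻ x, f i x ∂(μ i) := by
  induction n with
  | zero => simp
  | succ n ih =>
    have hm : Measurable fun x : Fin (n + 1) → E => ∏ i, f i (x i) :=
      Finset.measurable_prod _ fun i _ => (hf i).comp (measurable_pi_apply i)
    have hm' : Measurable fun x : Fin n → E => ∏ i, f i.succ (x i) :=
      Finset.measurable_prod _ fun i _ => (hf _).comp (measurable_pi_apply i)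
    have hmp : MeasurePreserving (MeasurableEquiv.piFinSuccAbove (fun _ => E) 0).symm
        ((μ 0).prod (Measure.pi fun i : Fin n => μ i.succ)) (Measure.pi μ) :=
      (measurePreserving_piFinSuccAbove μ 0).symm
    have hval : ∀ x : E × (Fin n → E),
        ∏ i, f i ((MeasurableEquiv.piFinSuccAbove (fun _ => E) 0).symm x i) =
          f 0 x.1 * ∏ i : Fin n, f i.succ (x.2 i) := fun x => by
      rw [Fin.prod_univ_succ]
      rfl
    rw [← hmp.lintegral_comp hm]
    simp_rw [hval]
    rw [lintegral_prod_mul (hf 0).aemeasurable hm'.aemeasurable, ih fun i => hf i.succ,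
      Fin.prod_univ_succ]

lemma pi_withDensity {n : ℕ} {E : Type*} {mE : MeasurableSpace E}
    {μ : Fin n → Measure E} [∀ i, SigmaFinite (μ i)] {f : Fin n → E → ℝ≥0∞}
    (hf : ∀ i, Measurable (f i)) [∀ i, SigmaFinite ((μ i).withDensity (f i))] :
    (Measure.pi μ).withDensity (fun x => ∏ i, f i (x i)) =
      Measure.pi fun i => (μ i).withDensity (f i) := by
  symm
  refine Measure.pi_eq fun s hs => ?_
  have hms : MeasurableSet (Set.pi Set.univ s) := MeasurableSet.univ_pi hs
  rw [withDensity_apply _ hms, ← lintegral_indicator hms]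
  have : ∀ x, (Set.pi Set.univ s).indicator (fun x => ∏ i, f i (x i)) x =
      ∏ i, (s i).indicator (f i) (x i) := by
    intro x
    by_cases hx : x ∈ Set.pi Set.univ s
    · rw [Set.indicator_of_mem hx]
      exact Finset.prod_congr rfl fun i _ =>
        (Set.indicator_of_mem (hx i (Set.mem_univ i)) _).symm
    · rw [Set.indicator_of_notMem hx]
      obtain ⟨i, hi⟩ : ∃ i, x i ∉ s i := by simpa [Set.mem_pi] using hx
      exact (Finset.prod_eq_zero (Finset.mem_univ i) (Set.indicator_of_notMem hi _)).symm
  simp_rw [this]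
  rw [lintegral_fin_prod_eq_prod fun i => (hf i).indicator (hs i)]
  exact Finset.prod_congr rfl fun i _ => by
    rw [lintegral_indicator (hs i), withDensity_apply _ (hs i)]

lemma pi_smul {n : ℕ} {E : Type*} {mE : MeasurableSpace E} {μ : Fin n → Measure E}
    [∀ i, IsProbabilityMeasure (μ i)] {c : Fin n → ℝ≥0∞}
    (hc : ∀ i, c i ≠ ∞) :
    Measure.pi (fun i => c i • μ i) = (∏ i, c i) • Measure.pi μ := by
  have : ∀ i, IsFiniteMeasure (c i • μ i) := fun i => ⟨by simpa using (hc i).lt_top⟩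
  refine Measure.pi_eq fun s hs => ?_
  simp [Measure.pi_pi, Finset.prod_mul_distrib]

end Product

lemma lintegral_withDensity_mul {α : Type*} [MeasurableSpace α] {μ : Measure α} {f g : α → ℝ≥0∞}
    (hf : Measurable f) (hg : Measurable g) :
    ∫⁻ x, g x ∂μ.withDensity f = ∫⁻ x, f x * g x ∂μ :=
  lintegral_withDensity_eq_lintegral_mul _ hf hg

/-! ### The latent block (l, κ). -/

section Augmented

/-- The weight `∏ exp (-κ_i η_i² / 2)` as a function of the latent `κ`. -/
noncomputable def kappaWeight {n : ℕ} (κ : Fin n → Set.Ioi (0 : ℝ)) (η : Fin n → ℝ) : ℝ≥0∞ :=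
  ∏ i, ENNReal.ofReal (Real.exp (-((κ i : ℝ) * η i ^ 2 / 2)))

variable {n : ℕ}

lemma measurable_kappaWeight {α : Type*} [MeasurableSpace α] {f : α → Fin n → Set.Ioi (0 : ℝ)}
    {g : α → Fin n → ℝ} (hf : Measurable f) (hg : Measurable g) :
    Measurable fun x => kappaWeight (f x) (g x) := by
  unfold kappaWeight; fun_prop

lemma kappaWeight_le_one (κ : Fin n → Set.Ioi (0 : ℝ)) (η : Fin n → ℝ) :
    kappaWeight κ η ≤ 1 := by
  refine Finset.prod_le_one' fun i _ => ?_
  rw [ENNReal.ofReal_le_one, Real.exp_le_one_iff]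
  have : (0 : ℝ) ≤ κ i := le_of_lt (κ i).2
  simp only [neg_nonpos]
  positivity

lemma kappaWeight_ne_zero (κ : Fin n → Set.Ioi (0 : ℝ)) (η : Fin n → ℝ) :
    kappaWeight κ η ≠ 0 :=
  Finset.prod_ne_zero_iff.2 fun i _ => by simpa using Real.exp_pos _

lemma pi_kgPos_withDensity {d : Fin n → ℕ} (hd : ∀ i, 1 ≤ d i) (η : Fin n → ℝ) :
    (Measure.pi fun i => kgPos (d i) 0).withDensity (fun κ => kappaWeight κ η) =
      (∏ i, kgTilt (d i) (η i)) • Measure.pi fun i => kgPos (d i) (η i) := by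
  have hd' : ∀ i, (0 : ℝ) < d i := fun i => by exact_mod_cast hd i
  have h0 := fun i => isProbabilityMeasure_kgPos (hd' i) 0
  have hη := fun i => isProbabilityMeasure_kgPos (hd' i) (η i)
  have hfin : ∀ i, IsFiniteMeasure (kgTilt (d i) (η i) • kgPos (d i) (η i)) := fun i =>
    ⟨by simpa using (kgTilt_ne_top (hd' i) _).lt_top⟩
  let f : Fin n → Set.Ioi (0 : ℝ) → ℝ≥0∞ := fun i x =>
    ENNReal.ofReal (Real.exp (-((x : ℝ) * η i ^ 2 / 2)))
  have hf : ∀ i, (kgPos (d i) 0).withDensity (f i) = kgTilt (d i) (η i) • kgPos (d i) (η i) :=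
    fun i => kgPos_withDensity (hd' i) _
  have hσ : ∀ i, SigmaFinite ((kgPos (d i) 0).withDensity (f i)) := fun i => by
    rw [hf i]
    exact @IsFiniteMeasure.toSigmaFinite _ _ _ (hfin i)
  have h1 := pi_smul (μ := fun i => kgPos (d i) (η i)) fun i => kgTilt_ne_top (hd' i) (η i)
  have hfm : ∀ i, Measurable (f i) := fun i => by fun_prop
  have h2 := pi_withDensity (μ := fun i => kgPos (d i) 0) hfm
  rw [← h1, ← funext hf]
  exact h2

/-- The left side does not involve c, the current linear predictor: this is the state-free lower
bound behind the minorization. -/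
lemma prod_kgTilt_le {d : Fin n → ℕ} (hd : ∀ i, 1 ≤ d i) (c η : Fin n → ℝ) :
    ∏ i, kgTilt (d i) (η i) ≤ ∫⁻ κ, kappaWeight κ η ∂Measure.pi fun i => kgPos (d i) (c i) := by
  have hd' : ∀ i, (0 : ℝ) < d i := fun i => by exact_mod_cast hd i
  have hη := fun i => isProbabilityMeasure_kgPos (hd' i) (c i)
  unfold kappaWeight
  rw [lintegral_fin_prod_eq_prod
    (f := fun i (x : Set.Ioi (0 : ℝ)) => ENNReal.ofReal (Real.exp (-((x : ℝ) * η i ^ 2 / 2))))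
    fun i => by fun_prop]
  exact Finset.prod_le_prod' fun i _ => kgTilt_le_lintegral_kgPos (hd' i) _ _

attribute [irreducible] kappaWeight

lemma lintegral_dirac_prod {I K : Type*} [MeasurableSpace I] [MeasurableSpace K] (l : I)
    (ν : Measure K) [SFinite ν] {F : I × K → ℝ≥0∞} (hF : Measurable F) :
    ∫⁻ x, F x ∂((Measure.dirac l).prod ν) = ∫⁻ κ, F (l, κ) ∂ν := by
  rw [lintegral_prod _ hF.aemeasurable, lintegral_dirac' _ hF.lintegral_prod_right']

lemma lintegral_discreteLaw_bind {I K : Type*} [Fintype I] [MeasurableSpace I]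
    [MeasurableSingletonClass I] [MeasurableSpace K] (v : I → ℝ) (D : I → Measure K)
    {F : K → ℝ≥0∞} (hF : Measurable F) :
    ∫⁻ x, F x ∂((discreteLaw v).bind D) =
      ∑ l, ENNReal.ofReal (v l / ∑ j, v j) * ∫⁻ x, F x ∂D l := by
  rw [Measure.lintegral_bind (measurable_of_finite D).aemeasurable hF.aemeasurable, discreteLaw,
    lintegral_finsetSum_measure]
  simp

lemma sum_discreteLaw_weights {I : Type*} [Fintype I] {v : I → ℝ} (hv : ∀ l, 0 ≤ v l)
    (hpos : 0 < ∑ l, v l) : ∑ l, ENNReal.ofReal (v l / ∑ j, v j) = 1 := by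
  rw [← ENNReal.ofReal_sum_of_nonneg fun l _ => div_nonneg (hv l) hpos.le, ← Finset.sum_div,
    div_self hpos.ne', ENNReal.ofReal_one]

variable {I : Type*} [Fintype I] [MeasurableSpace I]

/-- The reference measure of the latent variables `(l, κ)`. -/
noncomputable def latentBase (d : I → Fin n → ℕ) : Measure (I × (Fin n → Set.Ioi (0 : ℝ))) :=
  ∑ l, (Measure.dirac l).prod (Measure.pi fun i => kgPos (d l i) 0)

lemma isFiniteMeasure_latentBase {d : I → Fin n → ℕ} (hd : ∀ l i, 1 ≤ d l i) :
    IsFiniteMeasure (latentBase d) := by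
  have h0 := fun l i => isProbabilityMeasure_kgPos (b := d l i) (by exact_mod_cast hd l i) 0
  unfold latentBase
  infer_instance

lemma lintegral_latentBase {d : I → Fin n → ℕ} (hd : ∀ l i, 1 ≤ d l i)
    {F : I × (Fin n → Set.Ioi (0 : ℝ)) → ℝ≥0∞} (hF : Measurable F) :
    ∫⁻ a, F a ∂latentBase d =
      ∑ l, ∫⁻ κ, F (l, κ) ∂Measure.pi fun i => kgPos (d l i) 0 := by
  have h0 := fun l i => isProbabilityMeasure_kgPos (b := d l i) (by exact_mod_cast hd l i) 0
  rw [latentBase, lintegral_finsetSum_measure]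
  exact Finset.sum_congr rfl fun l _ => lintegral_dirac_prod l _ hF

/-- Tilting each component turns KG(·, 0) into KG(·, η) at the cost of the constants `kgTilt`, which
thereby enter the weights of l. -/
lemma lintegral_latentBase_withDensity [MeasurableSingletonClass I] {d : I → Fin n → ℕ}
    (hd : ∀ l i, 1 ≤ d l i) {F : I × (Fin n → Set.Ioi (0 : ℝ)) → ℝ≥0∞} (hF : Measurable F) (q : I → ℝ≥0∞)
    (η : Fin n → ℝ) :
    ∫⁻ a, F a ∂(latentBase d).withDensity (fun a => q a.1 * kappaWeight a.2 η) =
      ∑ l, q l * (∏ i, kgTilt (d l i) (η i)) *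
        ∫⁻ κ, F (l, κ) ∂Measure.pi fun i => kgPos (d l i) (η i) := by
  have hk : Measurable fun κ : Fin n → Set.Ioi (0 : ℝ) => kappaWeight κ η :=
    measurable_kappaWeight measurable_id measurable_const
  have hq : Measurable fun a : I × (Fin n → Set.Ioi (0 : ℝ)) => q a.1 * kappaWeight a.2 η :=
    ((measurable_of_finite q).comp measurable_fst).mul
      (measurable_kappaWeight measurable_snd measurable_const)
  have hqF : Measurable fun a => q a.1 * kappaWeight a.2 η * F a := hq.mul hF
  rw [lintegral_withDensity_mul hq hF, lintegral_latentBase hd hqF]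
  refine Finset.sum_congr rfl fun l _ => ?_
  have hFl : Measurable fun κ => F (l, κ) := hF.comp measurable_prodMk_left
  have h := congrArg (fun μ => ∫⁻ κ, F (l, κ) ∂μ) (pi_kgPos_withDensity (hd l) η)
  simp only [lintegral_smul_measure, smul_eq_mul] at h
  have hkF : Measurable fun κ => kappaWeight κ η * F (l, κ) := hk.mul hFl
  rw [lintegral_withDensity_mul hk hFl] at h
  rw [mul_assoc, ← h, ← lintegral_const_mul _ hkF]
  exact lintegral_congr fun κ => mul_assoc _ _ _

end Augmented

/-! ### The minorization for samplers with Kolmogorov-Gamma latents. -/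

section AugmentedGibbs

variable {n : ℕ} {I B : Type*} [Fintype I] [MeasurableSpace I] [MeasurableSingletonClass I]
  [MeasurableSpace B]

/-- The factor r is common to all l and cancels on normalization, so the weights used to draw l need
only be proportional to the marginal weights of the joint density. -/
lemma normalize_latentBase_eq_bind {d : I → Fin n → ℕ} (hd : ∀ l i, 1 ≤ d l i) {v : I → ℝ}
    (hv : ∀ l, 0 ≤ v l) (hpos : 0 < ∑ l, v l) {q : I → ℝ≥0∞} {η : Fin n → ℝ} {r : ℝ≥0∞}
    (hr0 : r ≠ 0) (hr1 : r ≠ ∞)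
    (hq : ∀ l, q l * ∏ i, kgTilt (d l i) (η i) = r * ENNReal.ofReal (v l)) :
    (discreteLaw v).bind (fun l => (Measure.dirac l).prod
        (Measure.pi fun i => kgPos (d l i) (η i))) =
      normalize ((latentBase d).withDensity fun a => q a.1 * kappaWeight a.2 η) := by
  have hη := fun l i => isProbabilityMeasure_kgPos (b := d l i) (by exact_mod_cast hd l i) (η i)
  refine Measure.ext_of_lintegral _ fun F hF => ?_
  have hmass : ((latentBase d).withDensity fun a => q a.1 * kappaWeight a.2 η) Set.univ =
      r * ENNReal.ofReal (∑ l, v l) := by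
    rw [← lintegral_one, lintegral_latentBase_withDensity hd measurable_const]
    simp only [hq, lintegral_const, measure_univ, mul_one]
    rw [← Finset.mul_sum, ENNReal.ofReal_sum_of_nonneg fun l _ => hv l]
  rw [lintegral_discreteLaw_bind _ _ hF, normalize, hmass, lintegral_smul_measure,
    lintegral_latentBase_withDensity hd hF, smul_eq_mul, Finset.mul_sum]
  refine Finset.sum_congr rfl fun l _ => ?_
  rw [hq, lintegral_dirac_prod l _ hF, ← mul_assoc, ENNReal.ofReal_div_of_pos hpos,
    ENNReal.mul_inv (.inl hr0) (.inl hr1), div_eq_mul_inv]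
  congr 1
  calc _ = (r⁻¹ * r) * (ENNReal.ofReal (v l) * (ENNReal.ofReal (∑ l, v l))⁻¹) := by
        rw [ENNReal.inv_mul_cancel hr0 hr1, one_mul]
    _ = _ := by ring

/-- A two-block Gibbs sampler with Kolmogorov-Gamma latent variables whose joint density is
`c l * w l b * exp (- ∑ κ_i η_i(b)² / 2)` is uniformly ergodic. -/
theorem uniformlyErgodic_augmented {d : I → Fin n → ℕ} (hd : ∀ l i, 1 ≤ d l i)
    {μB : Measure B} [IsProbabilityMeasure μB] {η : B → Fin n → ℝ} (hη : Measurable η)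
    {c : I → ℝ} {w : I → B → ℝ} (hw : ∀ l, Measurable (w l))
    (hwpos : ∀ l b, 0 < w l b) (hwfin : ∀ l, ∫⁻ b, ENNReal.ofReal (w l b) ∂μB ≠ ∞)
    {v : B → I → ℝ} (hv : ∀ b l, 0 ≤ v b l) (hvpos : ∀ b, 0 < ∑ l, v b l) {r : B → ℝ≥0∞}
    (hr0 : ∀ b, r b ≠ 0) (hr1 : ∀ b, r b ≠ ∞)
    (hq : ∀ b l, ENNReal.ofReal (c l) * ENNReal.ofReal (w l b) *
      ∏ i, kgTilt (d l i) (η b i) = r b * ENNReal.ofReal (v b l))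
    {upd₁ : B → Measure (I × (Fin n → Set.Ioi (0 : ℝ)))}
    {upd₂ : I × (Fin n → Set.Ioi (0 : ℝ)) → Measure B}
    (h₁ : ∀ b, upd₁ b = (discreteLaw (v b)).bind fun l => (Measure.dirac l).prod
        (Measure.pi fun i => kgPos (d l i) (η b i)))
    (h₂ : ∀ a, upd₂ a = normalize (μB.withDensity fun b =>
        ENNReal.ofReal (w a.1 b) * kappaWeight a.2 (η b))) :
    UniformlyErgodic (gibbsCycle upd₁ upd₂)
      (normalize (((latentBase d).prod μB).withDensity fun x =>
        ENNReal.ofReal (c x.1.1) * (ENNReal.ofReal (w x.1.1 x.2) * kappaWeight x.1.2 (η x.2)))) ∧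
    UniformlyErgodic (gibbsMarginal upd₁ upd₂)
      ((normalize (((latentBase d).prod μB).withDensity fun x =>
        ENNReal.ofReal (c x.1.1) * (ENNReal.ofReal (w x.1.1 x.2) *
          kappaWeight x.1.2 (η x.2)))).map Prod.snd) := by
  have hfin := isFiniteMeasure_latentBase hd
  have hkg := fun (b : B) l i =>
    isProbabilityMeasure_kgPos (b := d l i) (by exact_mod_cast hd l i) (η b i)
  have hkg0 := fun l i =>
    isProbabilityMeasure_kgPos (b := d l i) (by exact_mod_cast hd l i) 0
  have hw' : Measurable fun x : I × B => w x.1 x.2 := measurable_from_prod_countable_right hw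
  have hg : Measurable (Function.uncurry fun (a : I × (Fin n → Set.Ioi (0 : ℝ))) b =>
      ENNReal.ofReal (w a.1 b) * kappaWeight a.2 (η b)) :=
    (hw'.comp ((measurable_fst.comp measurable_fst).prodMk measurable_snd)).ennreal_ofReal.mul
      (measurable_kappaWeight (measurable_snd.comp measurable_fst) (hη.comp measurable_snd))
  have hc : Measurable fun a : I × (Fin n → Set.Ioi (0 : ℝ)) => ENNReal.ofReal (c a.1) :=
    (measurable_of_finite fun l => ENNReal.ofReal (c l)).comp measurable_fst
  set Z : I → ℝ≥0∞ := fun l => ∫⁻ b, ENNReal.ofReal (w l b) ∂μB with hZ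
  have hgle : ∀ a : I × (Fin n → Set.Ioi (0 : ℝ)),
      ∫⁻ b, ENNReal.ofReal (w a.1 b) * kappaWeight a.2 (η b) ∂μB ≤ Z a.1 := fun a =>
    lintegral_mono fun b => mul_le_of_le_one_right' (kappaWeight_le_one _ _)
  have hmB : ∀ F : B → ℝ≥0∞, Measurable F → (∀ b, F b ≠ 0) → ∫⁻ b, F b ∂μB ≠ 0 := by
    intro F hF h0 h
    rw [lintegral_eq_zero_iff hF] at h
    obtain ⟨b, hb⟩ := h.exists
    exact h0 b hb
  have hmass : ∀ b, ∫⁻ a, ENNReal.ofReal (c a.1) * (ENNReal.ofReal (w a.1 b) *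
      kappaWeight a.2 (η b)) ∂latentBase d = r b * ENNReal.ofReal (∑ l, v b l) := by
    intro b
    have h := lintegral_latentBase_withDensity hd (F := fun _ => 1) measurable_const
      (fun l => ENNReal.ofReal (c l) * ENNReal.ofReal (w l b)) (η b)
    rw [lintegral_one, withDensity_apply _ .univ, Measure.restrict_univ] at h
    simp only [hq, lintegral_const, measure_univ, mul_one] at h
    rw [← Finset.mul_sum, ← ENNReal.ofReal_sum_of_nonneg fun l _ => hv b l] at h
    rw [← h]
    exact lintegral_congr fun a => (mul_assoc _ _ _).symm
  have hub : ∀ b, upd₁ b = normalize ((latentBase d).withDensity fun a =>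
      ENNReal.ofReal (c a.1) * (ENNReal.ofReal (w a.1 b) * kappaWeight a.2 (η b))) := by
    intro b
    rw [h₁, normalize_latentBase_eq_bind hd (hv b) (hvpos b) (hr0 b) (hr1 b) (hq b)]
    simp_rw [mul_assoc]
  have hI : Nonempty I := by
    by_contra hne
    rw [not_nonempty_iff] at hne
    obtain ⟨b⟩ := nonempty_of_isProbabilityMeasure μB
    simpa using hvpos b
  -- The density of the minorizing measure. It is positive because the infimum is over a nonempty
  -- finite set, hence attained.
  set m : B → ℝ≥0∞ := fun b =>
    ⨅ l, (Z l)⁻¹ * (ENNReal.ofReal (w l b) * ∏ i, kgTilt (d l i) (η b i)) with hm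
  have hkgm : ∀ k : ℕ, 1 ≤ k → Measurable fun x => kgTilt k x := by
    intro k hk
    have hk' : (0 : ℝ) < k := by exact_mod_cast hk
    have := isProbabilityMeasure_kgPos hk' 0
    simp_rw [kgTilt_eq_lintegral_kgPos hk']
    refine Measurable.lintegral_prod_right
      (f := fun c (x : Set.Ioi (0 : ℝ)) => ENNReal.ofReal (Real.exp (-((x : ℝ) * c ^ 2 / 2)))) ?_
    fun_prop
  have hmm : Measurable m := by
    refine Measurable.iInf fun l => ?_
    refine ((hw l).ennreal_ofReal.mul (Finset.measurable_prod _ fun i _ => ?_)).const_mul _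
    exact (hkgm _ (hd l i)).comp ((measurable_pi_apply i).comp hη)
  have hm0 : ∀ b, m b ≠ 0 := by
    intro b
    obtain ⟨l, hl⟩ := exists_eq_ciInf_of_finite
      (f := fun l => (Z l)⁻¹ * (ENNReal.ofReal (w l b) * ∏ i, kgTilt (d l i) (η b i)))
    rw [hm]
    beta_reduce
    rw [← hl]
    refine mul_ne_zero (ENNReal.inv_ne_zero.2 (hwfin l)) (mul_ne_zero ?_ ?_)
    · simpa using hwpos l b
    · exact Finset.prod_ne_zero_iff.2 fun i _ => kgTilt_ne_zero (by exact_mod_cast hd l i) _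
  refine uniformlyErgodic_gibbs (IsProbabilityMeasure.ne_zero μB) hc hg h₂ ?_ ?_ hub ?_ ?_ ?_
    (ν := μB.withDensity m) ?_ ?_
  · intro a
    refine hmB _ (hg.comp measurable_prodMk_left) fun b => mul_ne_zero ?_ (kappaWeight_ne_zero _ _)
    simpa using hwpos a.1 b
  · exact fun a => ne_top_of_le_ne_top (hwfin a.1) (hgle a)
  · intro b
    rw [hmass]
    exact mul_ne_zero (hr0 b) (by simpa using hvpos b)
  · intro b
    rw [hmass]
    exact ENNReal.mul_ne_top (hr1 b) ENNReal.ofReal_ne_top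
  · have hle : ∫⁻ a, ENNReal.ofReal (c a.1) *
        ∫⁻ b, ENNReal.ofReal (w a.1 b) * kappaWeight a.2 (η b) ∂μB ∂latentBase d ≤
        ∑ l, ENNReal.ofReal (c l) * Z l := by
      refine (lintegral_mono fun a => mul_le_mul_right (hgle a) _).trans ?_
      rw [lintegral_latentBase hd (F := fun a => ENNReal.ofReal (c a.1) * Z a.1)
        ((measurable_of_finite fun l => ENNReal.ofReal (c l) * Z l).comp measurable_fst)]
      simp
    refine ne_top_of_le_ne_top ?_ hle
    exact (ENNReal.sum_lt_top.2 fun l _ =>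
      ENNReal.mul_lt_top ENNReal.ofReal_lt_top (hwfin l).lt_top).ne
  · intro h
    refine hmB m hmm hm0 ?_
    simpa using congrArg (fun μ => μ Set.univ) h
  · intro b
    refine Measure.le_iff.2 fun s hs => ?_
    have hupd : Measurable upd₂ := by
      rw [funext h₂]
      exact (densityKernel μB _ hg).measurable
    have hups : Measurable fun a => upd₂ a s := (Measure.measurable_coe hs).comp hupd
    rw [gibbsMarginal, Measure.bind_apply hs hupd.aemeasurable, h₁,
      lintegral_discreteLaw_bind _ _ hups, withDensity_apply _ hs]
    -- The weights of l sum to one whatever b is, so it suffices to bound each l separately.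
    calc ∫⁻ b' in s, m b' ∂μB
        = ∑ l, ENNReal.ofReal (v b l / ∑ j, v b j) * ∫⁻ b' in s, m b' ∂μB := by
          rw [← Finset.sum_mul, sum_discreteLaw_weights (hv b) (hvpos b), one_mul]
      _ ≤ _ := Finset.sum_le_sum fun l _ => mul_le_mul_right ?_ _
    rw [lintegral_dirac_prod l _ hups]
    have hgl : Measurable (Function.uncurry fun (κ : Fin n → Set.Ioi (0 : ℝ)) b' =>
        ENNReal.ofReal (w l b') * kappaWeight κ (η b')) :=
      ((hw l).comp measurable_snd).ennreal_ofReal.mul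
        (measurable_kappaWeight measurable_fst (hη.comp measurable_snd))
    -- Bound m by its l-th term and `kgTilt` by the average over κ, exchange the integrals, and
    -- finally enlarge Z l⁻¹ to the true inverse normalizing constant of the update.
    calc ∫⁻ b' in s, m b' ∂μB
        ≤ ∫⁻ b' in s, (Z l)⁻¹ * ∫⁻ κ, ENNReal.ofReal (w l b') * kappaWeight κ (η b')
            ∂(Measure.pi fun i => kgPos (d l i) (η b i)) ∂μB := by
          refine lintegral_mono fun b' => (iInf_le _ l).trans (mul_le_mul_right ?_ _)
          have hk : Measurable fun κ : Fin n → Set.Ioi (0 : ℝ) => kappaWeight κ (η b') :=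
            measurable_kappaWeight measurable_id measurable_const
          rw [lintegral_const_mul _ hk]
          exact mul_le_mul_right (prod_kgTilt_le (hd l) _ _) _
      _ = (Z l)⁻¹ * ∫⁻ κ, ∫⁻ b' in s, ENNReal.ofReal (w l b') * kappaWeight κ (η b') ∂μB
            ∂(Measure.pi fun i => kgPos (d l i) (η b i)) := by
          have hgl' : Measurable fun b' => ∫⁻ κ, ENNReal.ofReal (w l b') * kappaWeight κ (η b')
            ∂(Measure.pi fun i => kgPos (d l i) (η b i)) := hgl.lintegral_prod_left'
          rw [lintegral_const_mul _ hgl', lintegral_lintegral_swap]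
          exact (hgl.comp measurable_swap).aemeasurable
      _ = ∫⁻ κ, (Z l)⁻¹ * ∫⁻ b' in s, ENNReal.ofReal (w l b') * kappaWeight κ (η b') ∂μB
            ∂(Measure.pi fun i => kgPos (d l i) (η b i)) :=
          (lintegral_const_mul _ hgl.lintegral_prod_right').symm
      _ ≤ ∫⁻ κ, upd₂ (l, κ) s ∂(Measure.pi fun i => kgPos (d l i) (η b i)) := by
          refine lintegral_mono fun κ => ?_
          beta_reduce
          rw [h₂, normalize_withDensity_apply _ _ hs]
          gcongr
          exact hgle (l, κ)

end AugmentedGibbs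

/-! ### Gaussian densities and conjugacy. -/

section Gaussian

open scoped MatrixOrder

variable {p : ℕ}

lemma map_withDensity_comp {α β : Type*} [MeasurableSpace α] [MeasurableSpace β] {μ : Measure α}
    {e : α → β} (he : Measurable e) {f : β → ℝ≥0∞} (hf : Measurable f) :
    (μ.withDensity fun x => f (e x)).map e = (μ.map e).withDensity f := by
  ext s hs
  rw [Measure.map_apply he hs, withDensity_apply _ (he hs), withDensity_apply _ hs,
    Measure.restrict_map he hs, lintegral_map hf he]

/-- The Gaussian kernel `exp (- (x - m)ᵀ W (x - m) / 2)`. -/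
noncomputable def gaussKernel (W : Matrix (Fin p) (Fin p) ℝ) (m x : EuclideanSpace ℝ (Fin p)) :
    ℝ≥0∞ :=
  ENNReal.ofReal (Real.exp (-(WithLp.ofLp (x - m) ⬝ᵥ W *ᵥ WithLp.ofLp (x - m)) / 2))

lemma measurable_gaussKernel (W : Matrix (Fin p) (Fin p) ℝ) (m : EuclideanSpace ℝ (Fin p)) :
    Measurable (gaussKernel W m) := by
  unfold gaussKernel
  refine (Real.measurable_exp.comp ?_).ennreal_ofReal
  simp only [dotProduct, Matrix.mulVec]
  fun_prop

lemma exists_stdGaussian_eq :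
    ∃ c : ℝ≥0∞, c ≠ 0 ∧ c ≠ ∞ ∧ stdGaussian (EuclideanSpace ℝ (Fin p)) =
      c • volume.withDensity (gaussKernel 1 0) := by
  refine ⟨∏ _i : Fin p, ENNReal.ofReal (√(2 * Real.pi * (1 : NNReal)))⁻¹,
    Finset.prod_ne_zero_iff.2 fun i _ => ?_, ENNReal.prod_ne_top fun i _ =>
      ENNReal.ofReal_ne_top, ?_⟩
  · rw [Ne, ENNReal.ofReal_eq_zero, not_le]
    have := Real.pi_pos
    simp only [NNReal.coe_one, mul_one]
    positivity
  have hg : gaussianReal 0 1 = volume.withDensity (gaussianPDF 0 1) :=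
    gaussianReal_of_var_ne_zero 0 one_ne_zero
  have hσ : SigmaFinite ((volume : Measure ℝ).withDensity (gaussianPDF 0 1)) := by
    rw [← hg]; infer_instance
  have hpi := pi_withDensity (μ := fun _ : Fin p => (volume : Measure ℝ))
    (f := fun _ => gaussianPDF 0 1) fun _ => measurable_gaussianPDF 0 1
  rw [← map_pi_eq_stdGaussian, hg, ← hpi, ← withDensity_smul _ (measurable_gaussKernel _ _),
    ← (PiLp.volume_preserving_toLp (Fin p)).map_eq, ← map_withDensity_comp (by fun_prop)
      ((measurable_gaussKernel _ _).const_smul _), volume_pi]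
  congr 2
  funext x
  rw [Pi.smul_apply, gaussKernel, smul_eq_mul]
  simp_rw [gaussianPDF, gaussianPDFReal_def]
  rw [← ENNReal.ofReal_prod_of_nonneg fun i _ => by positivity,
    ← ENNReal.ofReal_prod_of_nonneg fun i _ => by positivity, ← ENNReal.ofReal_mul (by positivity),
    Finset.prod_mul_distrib, ← Real.exp_sum]
  congr 3
  simp only [sub_zero, Matrix.one_mulVec, dotProduct, NNReal.coe_one, mul_one]
  rw [← Finset.sum_neg_distrib, Finset.sum_div]
  exact Finset.sum_congr rfl fun i _ => by ring

/-- The multivariate normal law has a density proportional to the Gaussian kernel. -/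
lemma exists_multivariateGaussian_eq {S : Matrix (Fin p) (Fin p) ℝ} (hS : S.PosDef)
    (m : EuclideanSpace ℝ (Fin p)) :
    ∃ c : ℝ≥0∞, c ≠ 0 ∧ c ≠ ∞ ∧
      multivariateGaussian m S = c • volume.withDensity (gaussKernel S⁻¹ m) := by
  obtain ⟨c, hc0, hc1, hc⟩ := exists_stdGaussian_eq (p := p)
  set A := CFC.sqrt S with hA
  have hAA : A * A = S := CFC.sqrt_mul_sqrt_self _ hS.posSemidef.nonneg
  have hAdet : IsUnit A.det := by
    refine isUnit_iff_ne_zero.2 fun h => hS.det_pos.ne' ?_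
    rw [← hAA, Matrix.det_mul, h, zero_mul]
  have hAsymm : Aᵀ = A := by
    have := (Matrix.nonneg_iff_posSemidef.1 (CFC.sqrt_nonneg S)).isHermitian
    simpa [Matrix.IsHermitian] using this
  set L := Matrix.toEuclideanCLM (n := Fin p) (𝕜 := ℝ) A with hL
  have hdet : LinearMap.det (L : EuclideanSpace ℝ (Fin p) →ₗ[ℝ] EuclideanSpace ℝ (Fin p)) ≠ 0 := by
    intro h
    have h1 : (L : EuclideanSpace ℝ (Fin p) →ₗ[ℝ] EuclideanSpace ℝ (Fin p)) ∘ₗ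
        ((Matrix.toEuclideanCLM (n := Fin p) (𝕜 := ℝ) A⁻¹ :
          EuclideanSpace ℝ (Fin p) →L[ℝ] EuclideanSpace ℝ (Fin p)) :
          EuclideanSpace ℝ (Fin p) →ₗ[ℝ] EuclideanSpace ℝ (Fin p)) = LinearMap.id := by
      ext1 x
      apply (WithLp.ofLp_injective 2)
      change A *ᵥ (A⁻¹ *ᵥ WithLp.ofLp x) = WithLp.ofLp x
      rw [Matrix.mulVec_mulVec, Matrix.mul_nonsing_inv _ hAdet, Matrix.one_mulVec]
    have h2 := congrArg LinearMap.det h1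
    rw [LinearMap.det_comp, h, zero_mul, LinearMap.det_id] at h2
    exact zero_ne_one h2
  have hvol : (volume : Measure (EuclideanSpace ℝ (Fin p))).map (fun x => m + L x) =
      ENNReal.ofReal |(LinearMap.det (L : EuclideanSpace ℝ (Fin p) →ₗ[ℝ]
        EuclideanSpace ℝ (Fin p)))⁻¹| • volume := by
    have h := Measure.map_linearMap_addHaar_eq_smul_addHaar volume hdet
    rw [show (fun x => m + L x) = (fun x => m + x) ∘ L from rfl,
      ← Measure.map_map (measurable_const_add m) L.continuous.measurable]
    change (Measure.map (⇑(L : EuclideanSpace ℝ (Fin p) →ₗ[ℝ] EuclideanSpace ℝ (Fin p))) _).map _ = _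
    rw [h, Measure.map_smul, map_add_left_eq_self]
  refine ⟨c * ENNReal.ofReal |(LinearMap.det (L : EuclideanSpace ℝ (Fin p) →ₗ[ℝ]
    EuclideanSpace ℝ (Fin p)))⁻¹|, mul_ne_zero hc0 (by simpa using hdet),
    ENNReal.mul_ne_top hc1 ENNReal.ofReal_ne_top, ?_⟩
  -- With S = A A and A symmetric, the quadratic form of S⁻¹ at A x is |x|²; so x ↦ m + A x carries
  -- the standard kernel to the required one, and Lebesgue measure changes only by a determinant.
  have hker : gaussKernel (1 : Matrix (Fin p) (Fin p) ℝ) 0 =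
      fun x => gaussKernel S⁻¹ m (m + L x) := by
    funext x
    have hLx : WithLp.ofLp (L x) = A *ᵥ WithLp.ofLp x := rfl
    rw [gaussKernel, gaussKernel, sub_zero, add_sub_cancel_left, hLx, Matrix.one_mulVec,
      Matrix.mulVec_mulVec, ← hAA, Matrix.mul_inv_rev, mul_assoc,
      Matrix.nonsing_inv_mul _ hAdet, mul_one, Matrix.dotProduct_mulVec]
    nth_rewrite 1 [← hAsymm]
    rw [Matrix.mulVec_transpose, Matrix.vecMul_vecMul, Matrix.mul_nonsing_inv _ hAdet,
      Matrix.vecMul_one]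
  rw [multivariateGaussian, hc, Measure.map_smul, hker,
    map_withDensity_comp (by fun_prop) (measurable_gaussKernel _ _), hvol,
    withDensity_smul_measure, smul_smul]

/-- Completing the square, with z = W m as the linear coefficient. -/
lemma quadForm_sub {W : Matrix (Fin p) (Fin p) ℝ} (hW : Wᵀ = W) {m z : Fin p → ℝ}
    (hm : W *ᵥ m = z) (x : Fin p → ℝ) :
    (x - m) ⬝ᵥ W *ᵥ (x - m) = x ⬝ᵥ W *ᵥ x - 2 * (z ⬝ᵥ x) + m ⬝ᵥ z := by
  have h1 : m ⬝ᵥ W *ᵥ x = z ⬝ᵥ x := by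
    rw [Matrix.dotProduct_mulVec, ← hW, Matrix.vecMul_transpose, hm]
  rw [Matrix.mulVec_sub, sub_dotProduct, dotProduct_sub, dotProduct_sub, h1, hm,
    dotProduct_comm x z]
  ring

lemma kappaWeight_eq {n : ℕ} (κ : Fin n → Set.Ioi (0 : ℝ)) (η : Fin n → ℝ) :
    kappaWeight κ η = ENNReal.ofReal (Real.exp (-(∑ i, (κ i : ℝ) * η i ^ 2) / 2)) := by
  unfold kappaWeight
  rw [← ENNReal.ofReal_prod_of_nonneg fun i _ => (Real.exp_pos _).le, ← Real.exp_sum,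
    Finset.sum_neg_distrib, ← Finset.sum_div, neg_div]

/-- Conjugacy of the Gaussian prior. -/
lemma exists_withDensity_eq_condBeta {n : ℕ} (X : Matrix (Fin n) (Fin p) ℝ) (y : Fin n → ℝ)
    {S : Matrix (Fin p) (Fin p) ℝ} (hS : S.PosDef) (l : Fin n → ℕ) {κ : Fin n → ℝ}
    (hκ : ∀ i, 0 ≤ κ i) :
    ∃ c : ℝ≥0∞, c ≠ 0 ∧ c ≠ ∞ ∧
      (multivariateGaussian 0 S).withDensity (fun β => ENNReal.ofReal (Real.exp
        (∑ i, (l i : ℝ) * (y i - 0.5) * linPred X β i - (∑ i, κ i * linPred X β i ^ 2) / 2))) =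
      c • condBeta X y S l κ := by
  set W := Xᵀ * Matrix.diagonal κ * X + S⁻¹ with hWdef
  have hWpos : W.PosDef := by
    refine Matrix.PosDef.posSemidef_add ?_ hS.inv
    have := (Matrix.PosSemidef.diagonal (d := κ) hκ).conjTranspose_mul_mul_same X
    simpa using this
  have hWsymm : Wᵀ = W := by simpa [Matrix.IsHermitian] using hWpos.isHermitian
  have hWdet : IsUnit W.det := hWpos.det_pos.ne'.isUnit
  set u : Fin n → ℝ := fun i => y i * (l i : ℝ) - 0.5 * (l i : ℝ) with hu
  set m : Fin p → ℝ := W⁻¹ *ᵥ (Xᵀ *ᵥ u) with hm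
  have hWm : W *ᵥ m = Xᵀ *ᵥ u := by
    rw [hm, Matrix.mulVec_mulVec, Matrix.mul_nonsing_inv _ hWdet, Matrix.one_mulVec]
  obtain ⟨c₀, hc₀0, hc₀1, hc₀⟩ := exists_multivariateGaussian_eq hS 0
  obtain ⟨c₁, hc₁0, hc₁1, hc₁⟩ := exists_multivariateGaussian_eq hWpos.inv (WithLp.toLp 2 m)
  rw [Matrix.nonsing_inv_nonsing_inv _ hWdet] at hc₁
  set E := ENNReal.ofReal (Real.exp (m ⬝ᵥ (Xᵀ *ᵥ u) / 2)) with hE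
  have hE0 : E ≠ 0 := by simpa [hE] using Real.exp_pos _
  -- c₀ and c₁ are the normalizing constants of prior and conditional law; E is the constant left
  -- over from completing the square.
  refine ⟨c₀ * E * c₁⁻¹, mul_ne_zero (mul_ne_zero hc₀0 hE0) (ENNReal.inv_ne_zero.2 hc₁1),
    ENNReal.mul_ne_top (ENNReal.mul_ne_top hc₀1 ENNReal.ofReal_ne_top)
      (ENNReal.inv_ne_top.2 hc₁0), ?_⟩
  have hcond : condBeta X y S l κ = c₁ • volume.withDensity (gaussKernel W (WithLp.toLp 2 m)) :=
    hc₁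
  have hmeas : Measurable fun β : EuclideanSpace ℝ (Fin p) => ENNReal.ofReal (Real.exp
        (∑ i, (l i : ℝ) * (y i - 0.5) * linPred X β i - (∑ i, κ i * linPred X β i ^ 2) / 2)) := by
    simp only [linPred, Matrix.mulVec, dotProduct]
    fun_prop
  rw [hc₀, hcond, withDensity_smul_measure, ← withDensity_mul _ (measurable_gaussKernel _ _) hmeas,
    smul_smul, mul_assoc, ENNReal.inv_mul_cancel hc₁0 hc₁1, mul_one, ← smul_smul,
    ← withDensity_smul _ (measurable_gaussKernel _ _)]
  congr 2
  funext β
  rw [Pi.mul_apply, Pi.smul_apply, smul_eq_mul, gaussKernel, gaussKernel, hE,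
    ← ENNReal.ofReal_mul (Real.exp_pos _).le, ← ENNReal.ofReal_mul (Real.exp_pos _).le,
    ← Real.exp_add, ← Real.exp_add]
  congr 2
  rw [sub_zero, WithLp.ofLp_sub, quadForm_sub hWsymm hWm]
  set b := WithLp.ofLp β
  have hquad : b ⬝ᵥ W *ᵥ b = ∑ i, κ i * linPred X β i ^ 2 + b ⬝ᵥ S⁻¹ *ᵥ b := by
    rw [hWdef, Matrix.add_mulVec, dotProduct_add, ← Matrix.mulVec_mulVec, ← Matrix.mulVec_mulVec,
      Matrix.dotProduct_mulVec, Matrix.vecMul_transpose]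
    congr 1
    simp only [dotProduct, Matrix.mulVec_diagonal, linPred]
    exact Finset.sum_congr rfl fun i _ => by ring
  have hlin : (Xᵀ *ᵥ u) ⬝ᵥ b = ∑ i, (l i : ℝ) * (y i - 0.5) * linPred X β i := by
    rw [Matrix.mulVec_transpose, ← Matrix.dotProduct_mulVec]
    simp only [dotProduct, hu, linPred]
    exact Finset.sum_congr rfl fun i _ => by ring
  rw [hquad, hlin]
  ring

end Gaussian

/-! ### Positivity of the cobin base density via B-splines. -/

section CobinBase

/-- The cardinal B-spline of degree `m - 1`, up to the factor `(m - 1)!`. -/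
def cardinalSpline (m : ℕ) (x : ℝ) : ℝ :=
  ∑ k ∈ Finset.range (m + 1), (-1 : ℝ) ^ k * (m.choose k : ℝ) * (max (x - k) 0) ^ (m - 1)

/-- The B-spline recurrence, proved term by term: Pascal's rule and (m+1) C(m, j) = (j+1) C(m+1,
j+1) match the coefficients of each truncated power. -/
lemma cardinalSpline_succ {m : ℕ} (hm : 2 ≤ m) (x : ℝ) :
    cardinalSpline (m + 1) x =
      x * cardinalSpline m x + (m + 1 - x) * cardinalSpline m (x - 1) := by
  have hpow : ∀ a : ℝ, (max a 0) ^ m = a * (max a 0) ^ (m - 1) := fun a => by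
    -- The exponent m - 1 must be at least 1: for a < 0 the identity fails when 0 ^ 0 = 1 appears.
    obtain ⟨j, rfl⟩ : ∃ j, m = j + 2 := ⟨m - 2, by omega⟩
    rcases le_total a 0 with h | h
    · simp [max_eq_right h]
    · rw [max_eq_left h, show j + 2 - 1 = j + 1 by omega, pow_succ' a (j + 1)]
  have h1 : cardinalSpline m x = ∑ j ∈ Finset.range (m + 1), (-1 : ℝ) ^ (j + 1) *
      (m.choose (j + 1) : ℝ) * (max (x - (j + 1 : ℕ)) 0) ^ (m - 1) + (max x 0) ^ (m - 1) := by
    -- The extra term k = m + 1 has a zero binomial coefficient; adding it aligns the ranges of the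
    -- sums.
    have : cardinalSpline m x = ∑ k ∈ Finset.range (m + 2), (-1 : ℝ) ^ k * (m.choose k : ℝ) *
        (max (x - k) 0) ^ (m - 1) := by
      rw [Finset.sum_range_succ, Nat.choose_succ_self, cardinalSpline]
      simp
    rw [this, Finset.sum_range_succ']
    simp
  have h2 : cardinalSpline m (x - 1) = ∑ j ∈ Finset.range (m + 1), (-1 : ℝ) ^ j *
      (m.choose j : ℝ) * (max (x - (j + 1 : ℕ)) 0) ^ (m - 1) := by
    refine Finset.sum_congr rfl fun j _ => ?_
    push_cast
    rw [sub_sub, add_comm (1 : ℝ)]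
  rw [h1, h2, cardinalSpline, Finset.sum_range_succ', mul_add, Finset.mul_sum, Finset.mul_sum,
    add_right_comm, ← Finset.sum_add_distrib]
  congr 1
  · refine Finset.sum_congr rfl fun j _ => ?_
    rw [Nat.add_sub_cancel, hpow]
    have hc : ((m + 1).choose (j + 1) : ℝ) = m.choose j + m.choose (j + 1) := by
      exact_mod_cast Nat.choose_succ_succ m j
    have hd : ((m : ℝ) + 1) * m.choose j = (m + 1).choose (j + 1) * (j + 1) := by
      exact_mod_cast Nat.add_one_mul_choose_eq m j
    rw [hc] at hd ⊢
    push_cast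
    linear_combination (-1 : ℝ) ^ j * (-1) * (max (x - (j + 1)) 0) ^ (m - 1) * hd
  · rw [Nat.add_sub_cancel, hpow]
    simp

/-- Induction on m from the hat function at m = 2: inside (0, m + 1) the recurrence has positive
weights x and m + 1 - x, and at least one of the two splines it combines is positive. -/
lemma cardinalSpline_sign {m : ℕ} (hm : 2 ≤ m) (x : ℝ) :
    (x ≤ 0 → cardinalSpline m x = 0) ∧ (m ≤ x → cardinalSpline m x = 0) ∧
      (0 < x → x < m → 0 < cardinalSpline m x) := by
  induction m, hm using Nat.le_induction generalizing x with
  | base =>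
    have h : cardinalSpline 2 x = max x 0 - 2 * max (x - 1) 0 + max (x - 2) 0 := by
      simp only [cardinalSpline, Finset.sum_range_succ]
      norm_num [Nat.choose]
      ring
    rw [h]
    push_cast
    refine ⟨fun h0 => ?_, fun h0 => ?_, fun h0 h1 => ?_⟩
    · rw [max_eq_right h0, max_eq_right (by linarith), max_eq_right (by linarith)]; ring
    · rw [max_eq_left (by linarith), max_eq_left (by linarith), max_eq_left (by linarith)]; ring
    · rw [max_eq_left h0.le, max_eq_right (by linarith : x - 2 ≤ 0)]
      rcases le_total x 1 with h | h
      · rw [max_eq_right (by linarith)]; linarith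
      · rw [max_eq_left (by linarith)]; linarith
  | succ m hm ih =>
    rw [cardinalSpline_succ hm]
    obtain ⟨a1, a2, a3⟩ := ih x
    obtain ⟨b1, b2, b3⟩ := ih (x - 1)
    push_cast
    have hm' : (2 : ℝ) ≤ m := by exact_mod_cast hm
    refine ⟨fun h => ?_, fun h => ?_, fun h0 h1 => ?_⟩
    · rw [a1 h, b1 (by linarith)]; ring
    · rw [a2 (by linarith), b2 (by linarith)]; ring
    · rcases lt_or_ge x m with hx | hx
      · have hb : 0 ≤ cardinalSpline m (x - 1) := by
          rcases le_or_gt (x - 1) 0 with h | h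
          · exact (b1 h).ge
          · exact (b3 h (by linarith)).le
        have := mul_pos h0 (a3 h0 hx)
        have := mul_nonneg (by linarith : 0 ≤ (m : ℝ) + 1 - x) hb
        linarith
      · rw [a2 hx, mul_zero, zero_add]
        exact mul_pos (by linarith) (b3 (by linarith) (by linarith))

lemma cobinBase_pos {y : ℝ} (hy : y ∈ Set.Ioo (0 : ℝ) 1) {l : ℕ} (hl : 1 ≤ l) :
    0 < cobinBase y l := by
  unfold cobinBase
  split_ifs with h
  · exact one_pos
  · have hl2 : 2 ≤ l := by omega
    have hl0 : (0 : ℝ) < l := by exact_mod_cast hl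
    exact mul_pos (by positivity) ((cardinalSpline_sign hl2 (l * y)).2.2 (mul_pos hl0 hy.1)
      (by nlinarith [hy.2]))

lemma cobinBase_nonneg {y : ℝ} (hy : y ∈ Set.Icc (0 : ℝ) 1) {l : ℕ} (hl : 1 ≤ l) :
    0 ≤ cobinBase y l := by
  by_cases h : y ∈ Set.Ioo (0 : ℝ) 1
  · exact (cobinBase_pos h hl).le
  · unfold cobinBase
    split_ifs with h1
    · exact zero_le_one
    · have hl2 : 2 ≤ l := by omega
      refine (mul_eq_zero_of_right _ ?_).ge
      have hs := cardinalSpline_sign hl2 (l * y)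
      rcases hy.1.eq_or_lt with h0 | h0
      · exact hs.1 (by rw [← h0, mul_zero])
      · have : y = 1 := le_antisymm hy.2 (not_lt.1 fun h2 => h ⟨h0, h2⟩)
        exact hs.2.1 (by rw [this, mul_one])

end CobinBase

/-! ### The beta law on the open unit interval and its conjugacy. -/

section Beta

lemma betaUnit_eq_withDensity (a b : ℝ) :
    betaUnit a b = (volume.comap (Subtype.val : Set.Ioo (0 : ℝ) 1 → ℝ)).withDensity
      fun ψ => betaPDF a b ψ := by
  ext A hA
  rw [betaUnit, comap_subtype_coe_apply measurableSet_Ioo, betaMeasure,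
    withDensity_apply _ (measurableSet_Ioo.subtype_image hA), withDensity_apply _ hA]
  exact (setLIntegral_subtype measurableSet_Ioo A (betaPDF a b)).symm

lemma isProbabilityMeasure_betaUnit {a b : ℝ} (ha : 0 < a) (hb : 0 < b) :
    IsProbabilityMeasure (betaUnit a b) := by
  have := isProbabilityMeasureBeta ha hb
  refine ⟨?_⟩
  rw [betaUnit, comap_subtype_coe_apply measurableSet_Ioo, Set.image_univ, Subtype.range_coe,
    ← prob_compl_eq_zero_iff measurableSet_Ioo, betaMeasure,
    withDensity_apply _ measurableSet_Ioo.compl]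
  refine (setLIntegral_congr_fun measurableSet_Ioo.compl fun x hx => ?_).trans lintegral_zero
  rcases le_or_gt x 0 with h | h
  · exact betaPDF_eq_zero_of_nonpos h
  · exact betaPDF_eq_zero_of_one_le (not_lt.1 fun h1 => hx ⟨h, h1⟩)

/-- Conjugacy of the beta prior. -/
lemma exists_withDensity_eq_betaUnit {a b s t : ℝ} (ha : 0 < a) (hb : 0 < b) (has : 0 < a + s)
    (hbt : 0 < b + t) :
    ∃ c : ℝ≥0∞, c ≠ 0 ∧ c ≠ ∞ ∧ (betaUnit a b).withDensity (fun ψ : Set.Ioo (0 : ℝ) 1 =>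
      ENNReal.ofReal ((ψ : ℝ) ^ s * (1 - (ψ : ℝ)) ^ t)) = c • betaUnit (a + s) (b + t) := by
  have hB := beta_pos ha hb
  have hB' := beta_pos has hbt
  refine ⟨ENNReal.ofReal (beta (a + s) (b + t) / beta a b), ?_, ENNReal.ofReal_ne_top, ?_⟩
  · rw [Ne, ENNReal.ofReal_eq_zero, not_le]
    positivity
  have hm : ∀ a b, Measurable fun ψ : Set.Ioo (0 : ℝ) 1 => betaPDF a b ψ := fun a b =>
    (measurable_betaPDFReal a b).ennreal_ofReal.comp measurable_subtype_coe
  rw [betaUnit_eq_withDensity, betaUnit_eq_withDensity, ← withDensity_mul _ (hm a b) (by fun_prop),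
    ← withDensity_smul _ (hm _ _)]
  congr 1
  funext ψ
  obtain ⟨ψ, h0, h1⟩ := ψ
  have h1' : 0 < 1 - ψ := by linarith
  rw [Pi.mul_apply, Pi.smul_apply, betaPDF_of_pos_lt_one h0 h1, betaPDF_of_pos_lt_one h0 h1,
    smul_eq_mul, ← ENNReal.ofReal_mul (by positivity), ← ENNReal.ofReal_mul (by positivity)]
  congr 1
  rw [show a + s - 1 = (a - 1) + s by ring, show b + t - 1 = (b - 1) + t by ring,
    Real.rpow_add h0, Real.rpow_add h1']
  field_simp

end Beta

/-! ### Products of discrete laws. -/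

section DiscreteProduct

variable {n : ℕ} {J : Type*} [Fintype J] [MeasurableSpace J] [MeasurableSingletonClass J]

lemma discreteLaw_singleton (w : J → ℝ) (l : J) :
    discreteLaw w {l} = ENNReal.ofReal (w l / ∑ j, w j) := by
  classical
  simp [discreteLaw, Set.indicator_apply]

lemma isFiniteMeasure_discreteLaw {J : Type*} [Fintype J] [MeasurableSpace J] (w : J → ℝ) :
    IsFiniteMeasure (discreteLaw w) := by
  refine ⟨?_⟩
  simp [discreteLaw, ENNReal.sum_lt_top]

/-- The product of the normalizing sums expands into a sum over all choices l. Independent draws of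
the l_i thus become one draw from a finite set, as the general theorem requires. -/
lemma pi_discreteLaw {u : Fin n → J → ℝ} (hu : ∀ i j, 0 ≤ u i j) :
    Measure.pi (fun i => discreteLaw (u i)) =
      discreteLaw fun l : Fin n → J => ∏ i, u i (l i) := by
  have := fun i => isFiniteMeasure_discreteLaw (u i)
  refine Measure.ext_of_singleton fun l => ?_
  rw [Measure.pi_singleton, discreteLaw_singleton]
  simp only [discreteLaw_singleton]
  rw [← ENNReal.ofReal_prod_of_nonneg fun i _ =>
    div_nonneg (hu i _) (Finset.sum_nonneg fun j _ => hu i j), Finset.prod_div_distrib,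
    Finset.prod_univ_sum, Fintype.piFinset_univ]

end DiscreteProduct

/-! ### From the augmented likelihood to the cobin likelihood. -/

section Likelihood

variable {n : ℕ}

lemma ofReal_exp_mul_kappaWeight (s : ℝ) (κ : Fin n → Set.Ioi (0 : ℝ)) (η : Fin n → ℝ) :
    ENNReal.ofReal (Real.exp s) * kappaWeight κ η =
      ENNReal.ofReal (Real.exp (s - (∑ i, (κ i : ℝ) * η i ^ 2) / 2)) := by
  rw [kappaWeight_eq, ← ENNReal.ofReal_mul (Real.exp_pos _).le, ← Real.exp_add, neg_div,
    sub_eq_add_neg]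

variable {y : Fin n → ℝ}

lemma prod_augFactor (y : Fin n → ℝ) (l : Fin n → ℕ) (κ η : Fin n → ℝ) :
    ∏ i, augFactor (y i) (l i) (η i) (κ i) = (∏ i, cobinBase (y i) (l i)) *
      Real.exp (∑ i, (l i : ℝ) * (y i - 0.5) * η i - (∑ i, κ i * η i ^ 2) / 2) := by
  simp only [augFactor]
  rw [Finset.prod_mul_distrib, ← Real.exp_sum, Finset.sum_sub_distrib, Finset.sum_div]

lemma prod_cobinBase_mul_kgTilt (hy : ∀ i, y i ∈ Set.Icc (0 : ℝ) 1) {l : Fin n → ℕ}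
    (hl : ∀ i, 1 ≤ l i) (η : Fin n → ℝ) :
    ENNReal.ofReal (∏ i, cobinBase (y i) (l i)) *
        ENNReal.ofReal (Real.exp (∑ i, (l i : ℝ) * (y i - 0.5) * η i)) *
        ∏ i, kgTilt (l i) (η i) =
      ENNReal.ofReal (∏ i, cobinDensity (y i) (η i) (l i)) := by
  have hb := fun i => cobinBase_nonneg (hy i) (hl i)
  have hd : ∀ i, 0 ≤ Real.exp (l i * η i * y i) / expDiv (η i) ^ l i := fun i =>
    div_nonneg (Real.exp_pos _).le (pow_nonneg (expDiv_pos _).le _)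
  rw [mul_assoc, Real.exp_sum, ENNReal.ofReal_prod_of_nonneg fun i _ => (Real.exp_pos _).le,
    ← Finset.prod_mul_distrib]
  simp only [kgTilt_natCast_mul (hl _)]
  rw [← ENNReal.ofReal_prod_of_nonneg fun i _ => hd i,
    ← ENNReal.ofReal_mul (Finset.prod_nonneg fun i _ => hb i), ← Finset.prod_mul_distrib]
  simp only [cobinDensity, mul_div_assoc]

lemma cobinDensity_nonneg {y : ℝ} (hy : y ∈ Set.Icc (0 : ℝ) 1) {l : ℕ} (hl : 1 ≤ l) (θ : ℝ) :
    0 ≤ cobinDensity y θ l :=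
  div_nonneg (mul_nonneg (cobinBase_nonneg hy hl) (Real.exp_pos _).le)
    (pow_nonneg (expDiv_pos _).le _)

lemma cobinDensity_pos {y : ℝ} {l : ℕ} (hl : 1 ≤ l) (hy : 2 ≤ l → y ∈ Set.Ioo (0 : ℝ) 1)
    (θ : ℝ) : 0 < cobinDensity y θ l := by
  refine div_pos (mul_pos ?_ (Real.exp_pos _)) (pow_pos (expDiv_pos _) _)
  rcases hl.eq_or_lt with rfl | h
  · simp [cobinBase]
  · exact cobinBase_pos (hy h) hl

end Likelihood

/-! ### Conditional laws and integrability under the Gaussian prior. -/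

section Conjugacy

variable {n p : ℕ} (X : Matrix (Fin n) (Fin p) ℝ) (y : Fin n → ℝ)

lemma measurable_linPred : Measurable fun β : EuclideanSpace ℝ (Fin p) => linPred X β := by
  refine measurable_pi_lambda _ fun i => ?_
  simp only [linPred, Matrix.mulVec, dotProduct]
  fun_prop

lemma isProbabilityMeasure_condBeta (S : Matrix (Fin p) (Fin p) ℝ) (l : Fin n → ℕ)
    (κ : Fin n → ℝ) : IsProbabilityMeasure (condBeta X y S l κ) := by
  unfold condBeta
  infer_instance

lemma normalize_eq_of_eq_smul {A : Type*} [MeasurableSpace A] {μ ν : Measure A}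
    [IsProbabilityMeasure ν] {c : ℝ≥0∞} (h0 : c ≠ 0) (h1 : c ≠ ∞) (h : μ = c • ν) :
    normalize μ = ν := by
  rw [h, normalize_smul h0 h1, normalize_eq_self]

lemma exists_withDensity_kappaWeight {S : Matrix (Fin p) (Fin p) ℝ} (hS : S.PosDef)
    (l : Fin n → ℕ) (κ : Fin n → Set.Ioi (0 : ℝ)) :
    ∃ c : ℝ≥0∞, c ≠ 0 ∧ c ≠ ∞ ∧
      (multivariateGaussian 0 S).withDensity (fun β => ENNReal.ofReal (Real.exp
        (∑ i, (l i : ℝ) * (y i - 0.5) * linPred X β i)) * kappaWeight κ (linPred X β)) =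
      c • condBeta X y S l fun i => κ i := by
  simp only [ofReal_exp_mul_kappaWeight]
  exact exists_withDensity_eq_condBeta X y hS l fun i => (κ i).2.le

/-- Gaussian conjugacy at κ = 0: the integral is the finite constant c. It supplies the bound Z_l <
∞. -/
lemma lintegral_exp_linPred_ne_top {S : Matrix (Fin p) (Fin p) ℝ} (hS : S.PosDef)
    (l : Fin n → ℕ) :
    ∫⁻ β, ENNReal.ofReal (Real.exp (∑ i, (l i : ℝ) * (y i - 0.5) * linPred X β i))
      ∂multivariateGaussian 0 S ≠ ∞ := by
  obtain ⟨c, -, hc, h⟩ := exists_withDensity_eq_condBeta X y hS l (κ := 0) fun i => le_rfl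
  have := isProbabilityMeasure_condBeta X y S l 0
  have h := congrArg (fun μ => μ Set.univ) h
  simp only [Pi.zero_apply, zero_mul, Finset.sum_const_zero, zero_div, sub_zero,
    withDensity_apply _ MeasurableSet.univ, Measure.restrict_univ, Measure.smul_apply,
    measure_univ, smul_eq_mul, mul_one] at h
  rwa [h]

lemma measurable_exp_linPred (l : Fin n → ℕ) : Measurable fun β : EuclideanSpace ℝ (Fin p) =>
    Real.exp (∑ i, (l i : ℝ) * (y i - 0.5) * linPred X β i) := by
  have := fun i => (measurable_pi_apply i).comp (measurable_linPred X)
  simp only [Function.comp_def] at this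
  fun_prop

lemma sum_prod_eq_latentBase_prod {I B : Type*} [Fintype I] [MeasurableSpace I]
    [MeasurableSpace B] {μB : Measure B} [SFinite μB] (d : I → Fin n → ℕ) :
    ∑ l, ((Measure.dirac l).prod (Measure.pi fun i => kgPos (d l i) 0)).prod μB =
      (latentBase d).prod μB := by
  rw [latentBase, ← Measure.sum_fintype, ← Measure.sum_fintype, Measure.prod_sum_left]

end Conjugacy

/-! ### The two samplers as instances. -/

theorem uniformlyErgodic_cobin {n p : ℕ} (X : Matrix (Fin n) (Fin p) ℝ) {y : Fin n → ℝ}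
    (hy : ∀ i, y i ∈ Set.Icc (0 : ℝ) 1) {S : Matrix (Fin p) (Fin p) ℝ} (hS : S.PosDef) {L : ℕ}
    {pLam : PMF ℕ} (h : ∃ l : ℕ, 1 ≤ l ∧ l ≤ L ∧ pLam l ≠ 0 ∧
      (2 ≤ l → ∀ i, y i ∈ Set.Ioo (0 : ℝ) 1)) :
    UniformlyErgodic
        (gibbsCycle (cobinLatent X y pLam L) (cobinParam X y S L))
        (cobinPosterior X y S pLam L) ∧
      UniformlyErgodic
        (gibbsMarginal (cobinLatent X y pLam L) (cobinParam X y S L))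
        ((cobinPosterior X y S pLam L).map Prod.snd) := by
  have htarget : cobinPosterior X y S pLam L =
      normalize (((latentBase fun (l : Set.Icc 1 L) (_ : Fin n) => (l : ℕ)).prod
        (multivariateGaussian 0 S)).withDensity fun x =>
          ENNReal.ofReal ((pLam (x.1.1 : ℕ)).toReal * ∏ i, cobinBase (y i) x.1.1) *
          (ENNReal.ofReal (Real.exp
            (∑ i, ((x.1.1 : ℕ) : ℝ) * (y i - 0.5) * linPred X x.2 i)) *
            kappaWeight x.1.2 (linPred X x.2))) := by
    rw [cobinPosterior, ← sum_prod_eq_latentBase_prod]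
    congr 2
    funext x
    rw [ofReal_exp_mul_kappaWeight, ← ENNReal.ofReal_mul (mul_nonneg ENNReal.toReal_nonneg
      (Finset.prod_nonneg fun i _ => cobinBase_nonneg (hy i) x.1.1.2.1)),
      prod_augFactor y (fun _ => (x.1.1 : ℕ)) (fun i => x.1.2 i), mul_assoc]
  rw [htarget]
  refine uniformlyErgodic_augmented (d := fun (l : Set.Icc 1 L) (_ : Fin n) => (l : ℕ))
    (η := fun β => linPred X β) (r := fun _ => 1)
    (c := fun l => (pLam (l : ℕ)).toReal * ∏ i, cobinBase (y i) l)
    (w := fun l β => Real.exp (∑ i, ((l : ℕ) : ℝ) * (y i - 0.5) * linPred X β i))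
    (v := fun β l => (pLam (l : ℕ)).toReal * ∏ i, cobinDensity (y i) (linPred X β i) l)
    (fun l _ => l.2.1) (measurable_linPred X) (fun l => measurable_exp_linPred X y fun _ => l)
    (fun l β => Real.exp_pos _) (fun l => lintegral_exp_linPred_ne_top X y hS fun _ => l)
    ?_ ?_ (fun _ => one_ne_zero) (fun _ => ENNReal.one_ne_top) ?_ (fun β => rfl) ?_
  · exact fun β l => mul_nonneg ENNReal.toReal_nonneg
      (Finset.prod_nonneg fun i _ => cobinDensity_nonneg (hy i) l.2.1 _)
  · intro β
    obtain ⟨l, h1, hL, hp, hyl⟩ := h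
    refine Finset.sum_pos' (fun l _ => mul_nonneg ENNReal.toReal_nonneg
      (Finset.prod_nonneg fun i _ => cobinDensity_nonneg (hy i) l.2.1 _))
      ⟨⟨l, h1, hL⟩, Finset.mem_univ _, mul_pos (ENNReal.toReal_pos hp (pLam.apply_ne_top l))
        (Finset.prod_pos fun i _ => cobinDensity_pos h1 (fun h2 => hyl h2 i) _)⟩
  · intro β l
    rw [one_mul, ENNReal.ofReal_mul ENNReal.toReal_nonneg, ENNReal.ofReal_mul
      ENNReal.toReal_nonneg, ← prod_cobinBase_mul_kgTilt hy (fun _ => l.2.1), mul_assoc,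
      mul_assoc, mul_assoc]
  · intro a
    obtain ⟨c, hc0, hc1, hc⟩ := exists_withDensity_kappaWeight X y hS (fun _ => (a.1 : ℕ)) a.2
    have := isProbabilityMeasure_condBeta X y S (fun _ => (a.1 : ℕ)) fun i => a.2 i
    exact (normalize_eq_of_eq_smul hc0 hc1 hc).symm

/-- The negative binomial factors in the real-exponent form required by beta conjugacy; l_i ≥ 1
makes the truncated subtraction exact. -/
lemma prod_negbin_eq {n : ℕ} {l : Fin n → ℕ} (hl : ∀ i, 1 ≤ l i) (ψ : ℝ) :
    (∏ i, (1 - ψ) ^ (l i - 1)) * (ψ ^ 2) ^ n =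
      ψ ^ (2 * (n : ℝ)) * (1 - ψ) ^ (∑ i, (l i : ℝ) - n) := by
  have h1 : ∑ i, (l i : ℝ) - n = ((∑ i, (l i - 1) : ℕ) : ℝ) := by
    push_cast [Nat.cast_sub (hl _)]
    simp
  rw [h1, Real.rpow_natCast, show 2 * (n : ℝ) = ((2 * n : ℕ) : ℝ) by push_cast; rfl,
    Real.rpow_natCast, Finset.prod_pow_eq_pow_sum, pow_mul, mul_comm]

theorem uniformlyErgodic_micobin {n p : ℕ} (X : Matrix (Fin n) (Fin p) ℝ) {y : Fin n → ℝ}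
    (hy : ∀ i, y i ∈ Set.Icc (0 : ℝ) 1) {S : Matrix (Fin p) (Fin p) ℝ} (hS : S.PosDef) {L : ℕ}
    (hL : 1 ≤ L) {aψ bψ : ℝ} (ha : 0 < aψ) (hb : 0 < bψ) :
    UniformlyErgodic
        (gibbsCycle (micobinLatent X y L) (micobinParam X y S aψ bψ L))
        (micobinPosterior X y S aψ bψ L) ∧
      UniformlyErgodic
        (gibbsMarginal (micobinLatent X y L) (micobinParam X y S aψ bψ L))
        ((micobinPosterior X y S aψ bψ L).map Prod.snd) := by
  have hbeta := isProbabilityMeasure_betaUnit ha hb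
  have hψ0 : ∀ ψ : Set.Ioo (0 : ℝ) 1, 0 < (ψ : ℝ) := fun ψ => ψ.2.1
  have hψ1 : ∀ ψ : Set.Ioo (0 : ℝ) 1, 0 < 1 - (ψ : ℝ) := fun ψ => sub_pos.2 ψ.2.2
  set g : (Fin n → Set.Icc 1 L) → Set.Ioo (0 : ℝ) 1 → ℝ := fun l ψ =>
    (∏ i, (1 - (ψ : ℝ)) ^ ((l i : ℕ) - 1)) * ((ψ : ℝ) ^ 2) ^ n with hg
  have hgpos : ∀ l ψ, 0 < g l ψ := fun l ψ =>
    mul_pos (Finset.prod_pos fun i _ => pow_pos (hψ1 ψ) _) (pow_pos (pow_pos (hψ0 ψ) _) _)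
  -- Since the ψ-factor is at most 1, integrability of w reduces to the Gaussian part.
  have hgle : ∀ l ψ, g l ψ ≤ 1 := fun l ψ => by
    have h1 : 1 - (ψ : ℝ) ≤ 1 := by linarith [hψ0 ψ]
    exact mul_le_one₀ (Finset.prod_le_one (fun i _ => (pow_pos (hψ1 ψ) _).le)
      fun i _ => pow_le_one₀ (hψ1 ψ).le h1) (by positivity)
      (pow_le_one₀ (by positivity) (pow_le_one₀ (hψ0 ψ).le ψ.2.2.le))
  have hgm : ∀ l, Measurable (g l) := fun l => by fun_prop
  set e : (Fin n → Set.Icc 1 L) → EuclideanSpace ℝ (Fin p) → ℝ := fun l β =>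
    Real.exp (∑ i, ((l i : ℕ) : ℝ) * (y i - 0.5) * linPred X β i) with he
  have hem : ∀ l, Measurable (e l) := fun l => measurable_exp_linPred X y fun i => l i
  have hepos : ∀ l β, 0 < e l β := fun l β => Real.exp_pos _
  have hcnn : ∀ l : Fin n → Set.Icc 1 L, 0 ≤ ∏ i, ((l i : ℕ) : ℝ) * cobinBase (y i) (l i) :=
    fun l => Finset.prod_nonneg fun i _ =>
      mul_nonneg (Nat.cast_nonneg _) (cobinBase_nonneg (hy i) (l i).2.1)
  have hunn : ∀ (b : EuclideanSpace ℝ (Fin p) × Set.Ioo (0 : ℝ) 1) i (j : Set.Icc 1 L),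
      0 ≤ ((j : ℕ) : ℝ) * (1 - (b.2 : ℝ)) ^ ((j : ℕ) - 1) *
        cobinDensity (y i) (linPred X b.1 i) j := fun b i j =>
    mul_nonneg (mul_nonneg (Nat.cast_nonneg _) (pow_pos (hψ1 b.2) _).le)
      (cobinDensity_nonneg (hy i) j.2.1 _)
  have htarget : micobinPosterior X y S aψ bψ L =
      normalize (((latentBase fun (l : Fin n → Set.Icc 1 L) i => (l i : ℕ)).prod
        ((multivariateGaussian 0 S).prod (betaUnit aψ bψ))).withDensity fun x =>
          ENNReal.ofReal (∏ i, ((x.1.1 i : ℕ) : ℝ) * cobinBase (y i) (x.1.1 i)) *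
          (ENNReal.ofReal (g x.1.1 x.2.2 * e x.1.1 x.2.1) *
            kappaWeight x.1.2 (linPred X x.2.1))) := by
    rw [micobinPosterior, ← sum_prod_eq_latentBase_prod]
    congr 2
    funext x
    rw [ENNReal.ofReal_mul (hgpos _ _).le, mul_assoc, he, ofReal_exp_mul_kappaWeight,
      ← ENNReal.ofReal_mul (hgpos _ _).le, ← ENNReal.ofReal_mul (hcnn _), Finset.prod_mul_distrib,
      Finset.prod_mul_distrib, Finset.prod_mul_distrib, Finset.prod_mul_distrib,
      Finset.prod_const, Finset.card_univ, Fintype.card_fin,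
      prod_augFactor y (fun i => (x.1.1 i : ℕ)) (fun i => x.1.2 i)]
    congr 1
    simp only [hg]
    ring
  rw [htarget]
  refine uniformlyErgodic_augmented (d := fun (l : Fin n → Set.Icc 1 L) i => (l i : ℕ))
    (η := fun b : EuclideanSpace ℝ (Fin p) × Set.Ioo (0 : ℝ) 1 => linPred X b.1)
    -- The joint density carries ψ² per observation, which the weights for drawing l omit; r
    -- restores this l-free factor.
    (r := fun b => ENNReal.ofReal (((b.2 : ℝ) ^ 2) ^ n))
    (c := fun l => ∏ i, ((l i : ℕ) : ℝ) * cobinBase (y i) (l i))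
    (w := fun l b => g l b.2 * e l b.1)
    (v := fun b l => ∏ i, (((l i : ℕ) : ℝ) * (1 - (b.2 : ℝ)) ^ ((l i : ℕ) - 1) *
        cobinDensity (y i) (linPred X b.1 i) (l i)))
    (fun l i => (l i).2.1) ((measurable_linPred X).comp measurable_fst)
    (fun l => ((hgm l).comp measurable_snd).mul ((hem l).comp measurable_fst))
    (fun l b => mul_pos (hgpos _ _) (hepos _ _)) ?_
    (fun b l => Finset.prod_nonneg fun i _ => hunn b i (l i)) ?_
    (fun b => ?_) (fun b => ENNReal.ofReal_ne_top) ?_ ?_ ?_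
  · intro l
    refine ne_top_of_le_ne_top (lintegral_exp_linPred_ne_top X y hS fun i => l i) ?_
    rw [← (measurePreserving_fst (μ := multivariateGaussian 0 S)
      (ν := betaUnit aψ bψ)).lintegral_comp (hem l).ennreal_ofReal]
    exact lintegral_mono fun b => ENNReal.ofReal_le_ofReal
      (mul_le_of_le_one_left (hepos _ _).le (hgle _ _))
  · intro b
    refine Finset.sum_pos' (fun l _ => Finset.prod_nonneg fun i _ => hunn b i (l i))
      -- The choice l_i = 1 always has positive weight, even for y_i at the endpoints, because h(y,
      -- 1) = 1.
      ⟨fun _ => ⟨1, le_rfl, hL⟩, Finset.mem_univ _, Finset.prod_pos fun i _ => ?_⟩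
    have := cobinDensity_pos (y := y i) le_rfl (by norm_num) (linPred X b.1 i)
    simpa using this
  · rw [Ne, ENNReal.ofReal_eq_zero, not_le]
    exact pow_pos (pow_pos (hψ0 b.2) _) _
  · intro b l
    have hq := prod_cobinBase_mul_kgTilt hy (fun i => (l i).2.1) (linPred X b.1)
    have hbase : 0 ≤ ∏ i, cobinBase (y i) (l i) :=
      Finset.prod_nonneg fun i _ => cobinBase_nonneg (hy i) (l i).2.1
    have h1 : 0 ≤ ∏ i, ((l i : ℕ) : ℝ) := Finset.prod_nonneg fun i _ => Nat.cast_nonneg _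
    have h2 : 0 ≤ ∏ i, (1 - (b.2 : ℝ)) ^ ((l i : ℕ) - 1) :=
      Finset.prod_nonneg fun i _ => (pow_pos (hψ1 b.2) _).le
    rw [Finset.prod_mul_distrib, Finset.prod_mul_distrib, Finset.prod_mul_distrib,
      ENNReal.ofReal_mul h1, ENNReal.ofReal_mul (hgpos _ _).le, hg, ENNReal.ofReal_mul h2,
      ENNReal.ofReal_mul (mul_nonneg h1 h2), ENNReal.ofReal_mul h1, ← hq]
    ring
  · intro b
    rw [micobinLatent, pi_discreteLaw (hunn b)]
  · intro a
    obtain ⟨c, hc0, hc1, hc⟩ := exists_withDensity_kappaWeight X y hS (fun i => (a.1 i : ℕ)) a.2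
    have := isProbabilityMeasure_condBeta X y S (fun i => (a.1 i : ℕ)) fun i => a.2 i
    have hl1 : ∀ i, 1 ≤ (a.1 i : ℕ) := fun i => (a.1 i).2.1
    -- As every l_i ≥ 1, the second beta parameter is at least b_ψ, hence positive.
    have hsum : 0 ≤ ∑ i, ((a.1 i : ℕ) : ℝ) - n := by
      have h := Finset.card_nsmul_le_sum Finset.univ (fun i => ((a.1 i : ℕ) : ℝ)) 1
        fun i _ => by exact_mod_cast hl1 i
      simp only [Finset.card_univ, Fintype.card_fin, nsmul_eq_mul, mul_one] at h
      linarith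
    have has : 0 < aψ + 2 * (n : ℝ) := by positivity
    have hbt : 0 < bψ + (∑ i, ((a.1 i : ℕ) : ℝ) - n) := by linarith
    obtain ⟨c', hc0', hc1', hc'⟩ := exists_withDensity_eq_betaUnit ha hb has hbt
    have := isProbabilityMeasure_betaUnit has hbt
    rw [micobinParam, show bψ - (n : ℝ) + ∑ i, ((a.1 i : ℕ) : ℝ) =
      bψ + (∑ i, ((a.1 i : ℕ) : ℝ) - n) by ring]
    symm
    refine normalize_eq_of_eq_smul (mul_ne_zero hc0 hc0') (ENNReal.mul_ne_top hc1 hc1') ?_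
    have hf : Measurable fun β : EuclideanSpace ℝ (Fin p) => ENNReal.ofReal (Real.exp
        (∑ i, ((a.1 i : ℕ) : ℝ) * (y i - 0.5) * linPred X β i)) * kappaWeight a.2 (linPred X β) :=
      (hem a.1).ennreal_ofReal.mul (measurable_kappaWeight measurable_const (measurable_linPred X))
    have hf' : Measurable fun ψ : Set.Ioo (0 : ℝ) 1 => ENNReal.ofReal
        ((ψ : ℝ) ^ (2 * (n : ℝ)) * (1 - (ψ : ℝ)) ^ (∑ i, ((a.1 i : ℕ) : ℝ) - n)) := by fun_prop
    rw [← smul_smul, ← Measure.prod_smul_right, ← Measure.prod_smul_left, ← hc, ← hc',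
      prod_withDensity hf hf']
    congr 1
    funext b
    rw [ENNReal.ofReal_mul (hgpos _ _).le, ← prod_negbin_eq hl1]
    ring

end CobinGibbs

theorem theorem3 {n p : ℕ} (X : Matrix (Fin n) (Fin p) ℝ) (y : Fin n → ℝ)
    (hy : ∀ i, y i ∈ Set.Icc (0 : ℝ) 1)
    (S : Matrix (Fin p) (Fin p) ℝ) (hS : S.PosDef) (L : ℕ) (hL : 1 ≤ L) :
    -- cobin regression
    (∀ pLam : PMF ℕ, pLam 0 = 0 →
      (∃ l : ℕ, 1 ≤ l ∧ l ≤ L ∧ pLam l ≠ 0 ∧ (2 ≤ l → ∀ i, y i ∈ Set.Ioo (0 : ℝ) 1)) →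
      UniformlyErgodic
        (gibbsCycle (cobinLatent X y pLam L) (cobinParam X y S L))
        (cobinPosterior X y S pLam L) ∧
      UniformlyErgodic
        (gibbsMarginal (cobinLatent X y pLam L) (cobinParam X y S L))
        ((cobinPosterior X y S pLam L).map Prod.snd)) ∧
    -- micobin regression
    (∀ aψ bψ : ℝ, 0 < aψ → 0 < bψ →
      UniformlyErgodic
        (gibbsCycle (micobinLatent X y L) (micobinParam X y S aψ bψ L))
        (micobinPosterior X y S aψ bψ L) ∧
      UniformlyErgodic
        (gibbsMarginal (micobinLatent X y L) (micobinParam X y S aψ bψ L))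
        ((micobinPosterior X y S aψ bψ L).map Prod.snd)) := by
  exact ⟨fun pLam _ h => uniformlyErgodic_cobin X hy hS h,
    fun aψ bψ ha hb => uniformlyErgodic_micobin X hy hS hL ha hb⟩
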